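/- Let $n\ge 1$. A function $f:\mathbb R^n\to\mathbb C$ is \emph{Henstock–Kurzweil (HK) integrable over $\mathbb R^n$ with integral $I$} if, with $f$ extended by $0$ to $[-\infty,\infty]^n\setminus\mathbb R^n$, for every $\varepsilon>0$ there is a gauge $\gamma$ (an open neighbourhood $\gamma(x)$ of each $x\in[-\infty,\infty]^n$) such that $\bigl|\sum_c f(x_c)\,|J_c|-I\bigr|<\varepsilon$ for every finite partition of $[-\infty,\infty]^n$ into nonoverlapping closed intervals $J_c$ with tags $x_c\in J_c\subseteq\gamma(x_c)$ (with $0\cdot\infty=0$). Its Alexiewicz norm is $\|f\|_{A_n}=\sup_{x\in\mathbb R^n}\bigl|(HK)\int_{(-\infty,x_1]\times\cdots\times(-\infty,x_n]}f\bigr|$. For $k\ge1$ put $a_k=\pi2^{k-1}$, $\varepsilon_k=2^{-(k+1)}$; let $h_k(x)=\int_0^\infty\exp(-y^{a_k}e^{ia_kx})\,dy$ for $|x|<\pi/(2a_k)=2^{-k}$ and $h_k(x)=0$ otherwise; let $f_k(x)=c_k\exp\bigl(\varepsilon_k^2/(x^2-\varepsilon_k^2)\bigr)$ for $|x|<\varepsilon_k$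 and $f_k(x)=0$ otherwise, where $c_k$ is chosen so that $\int f_k=1$. Let $\chi_k=f_k*h_k$, $\alpha_k=\int e^{iz}f_k(z)\,dz$ and $\xi_k(x)=\chi_k(-x)/(n\,h_k(0)\,\alpha_k)$, a smooth compactly supported function on $\mathbb R$ with $\xi_k(x)=\tfrac1n e^{ix}$ for $|x|\le\varepsilon_k$. Enumerate the pairs $(k,q)$, $k\ge1$, $q\in\mathbb Q^n$, as a sequence indexed by $m\ge1$ in any way, and for $m=(k,q)$ define the Jones functions in either of the following two ways: (a) (vector fields, $d=n$) $\mathcal E_m(x)=(\xi_k(x_1-q_1),\dots,\xi_k(x_n-q_n))$ on the closed cube with centre $q$ and edge $2\varepsilon_k$, and $\mathcal E_m(x)=0$ off this cube; (b) (smooth scalar functions, $d=1$) $\mathcal E_m(x)=\prod_{j=1}^n\xi_k(x_j-q_j)$. Let $F_m(g)=\int_{\mathbb R^n}\mathcal E_m\cdot g\,d\lambda_n$ for $g\in L^1(\mathbb R^n;\mathbb C^d)$, where $u\cdot v=\sum_j u_jv_j$, and let $SD^2(\mathbb R^n)$ be the Hilbert space completion of $L^1(\mathbb R^n;\mathbb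 C^d)$ for the (semi-definite) inner product $(f,g)=\sum_{m\ge1}2^{-m}F_m(f)\overline{F_m(g)}$; each $F_m$ extends continuously to $SD^2(\mathbb R^n)$. \textbf{Lemma.} In both cases every HK-integrable function on $\mathbb R^n$ belongs to $SD^2(\mathbb R^n)$. That is, there is a constant $C$ depending only on $n$ such that for every enumeration and every $f:\mathbb R^n\to\mathbb C^d$ whose components are HK integrable over $\mathbb R^n$, there is a unique $u\in SD^2(\mathbb R^n)$ such that, for all $m$, $\mathcal E_m\cdot f$ is HK integrable over $\mathbb R^n$ and $F_m(u)=(HK)\int_{\mathbb R^n}\mathcal E_m\cdot f\,d\lambda_n$; moreover $\|u\|_{SD^2}\le C\sum_{j=1}^d\|f_j\|_{A_n}$. -/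

import Mathlib

open MeasureTheory

noncomputable section

namespace Jones

/-! ### The Henstock–Kurzweil integral over `ℝⁿ`

Gauges and partitions live on the compact space `[-∞, ∞]ⁿ`; the integrand is extended by `0` to the
points having an infinite coordinate. -/

/-- A tagged cell of `[-∞, ∞]ⁿ`: the closed interval `[lower, upper]` with the tag `tag`. -/
structure Cell (n : ℕ) where
  tag : Fin n → EReal
  lower : Fin n → EReal
  upper : Fin n → EReal

/-- A tagged partition of `[-∞, ∞]ⁿ` into finitely many nondegenerate nonoverlapping closed
intervals, each containing its tag. -/
structure TaggedPartition (n : ℕ) where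
  cells : Finset (Cell n)
  lower_lt_upper : ∀ c ∈ cells, ∀ i, c.lower i < c.upper i
  tag_mem : ∀ c ∈ cells, c.tag ∈ Set.Icc c.lower c.upper
  nonoverlapping : ∀ c ∈ cells, ∀ c' ∈ cells, c ≠ c' →
    Disjoint (Set.univ.pi fun i => Set.Ioo (c.lower i) (c.upper i))
      (Set.univ.pi fun i => Set.Ioo (c'.lower i) (c'.upper i))
  covers : ∀ x : Fin n → EReal, ∃ c ∈ cells, x ∈ Set.Icc c.lower c.upper

/-- The partition is subordinate to the gauge `γ`. -/
def TaggedPartition.IsFine {n : ℕ} (P : TaggedPartition n)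
    (γ : (Fin n → EReal) → Set (Fin n → EReal)) : Prop :=
  ∀ c ∈ P.cells, Set.Icc c.lower c.upper ⊆ γ c.tag

open Classical in
/-- Extension of `f` by `0` to the points at infinity. -/
def extendZero {n : ℕ} (f : (Fin n → ℝ) → ℂ) (x : Fin n → EReal) : ℂ :=
  if ∀ i, x i ≠ ⊥ ∧ x i ≠ ⊤ then f (fun i => (x i).toReal) else 0

/-- Volume of a bounded cell. (An unbounded cell whose tag is at infinity contributes `0` to every
Riemann sum, whatever this value is; an unbounded cell with a finite tag is excluded
by any gauge whose value at each finite point is bounded.) -/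
def Cell.volume {n : ℕ} (c : Cell n) : ℝ :=
  ∏ i, ((c.upper i).toReal - (c.lower i).toReal)

def TaggedPartition.riemannSum {n : ℕ} (P : TaggedPartition n) (f : (Fin n → ℝ) → ℂ) : ℂ :=
  ∑ c ∈ P.cells, (c.volume : ℂ) * extendZero f c.tag

/-- `f` is Henstock–Kurzweil integrable over `ℝⁿ` with integral `I`. -/
def HasHKIntegral {n : ℕ} (f : (Fin n → ℝ) → ℂ) (I : ℂ) : Prop :=
  ∀ ε : ℝ, 0 < ε → ∃ γ : (Fin n → EReal) → Set (Fin n → EReal),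
    (∀ x, IsOpen (γ x) ∧ x ∈ γ x) ∧
      ∀ P : TaggedPartition n, P.IsFine γ → ‖P.riemannSum f - I‖ < ε

def HKIntegrable {n : ℕ} (f : (Fin n → ℝ) → ℂ) : Prop := ∃ I, HasHKIntegral f I

open Classical in
/-- The Henstock–Kurzweil integral of `f` over `ℝⁿ` (`0` if `f` is not integrable). -/
def hkIntegral {n : ℕ} (f : (Fin n → ℝ) → ℂ) : ℂ :=
  if h : HKIntegrable f then h.choose else 0

/-- The Alexiewicz norm: the supremum over `x` of `|∫_{(-∞,x₁] × ⋯ × (-∞,xₙ]} f|`. -/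
def alexiewiczNorm {n : ℕ} (f : (Fin n → ℝ) → ℂ) : ℝ :=
  ⨆ x : Fin n → ℝ, ‖hkIntegral ((Set.Iic x).indicator f)‖

/-! ### The one-dimensional Jones functions -/

/-- `g(x, y) = exp(-y^a e^{iax})`. -/
def g (a x y : ℝ) : ℂ :=
  Complex.exp (-(((y ^ a : ℝ) : ℂ) * Complex.exp (Complex.I * (a * x : ℝ))))

/-- `h(x) = ∫_0^∞ g(x, y) dy` for `|x| < π / (2a)`, and `0` otherwise. -/
def h (a x : ℝ) : ℂ :=
  if |x| < Real.pi / (2 * a) then ∫ y in Set.Ioi (0 : ℝ), g a x y else 0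

/-- The exponent `a_k = π 2^{k-1}`. -/
def expo (k : ℕ) : ℝ := Real.pi * 2 ^ k / 2

/-- `h_k`, supported in `[-2^{-k}, 2^{-k}]`. -/
def hk (k : ℕ) (x : ℝ) : ℂ := h (expo k) x

/-- `ε_k = 2^{-(k+1)}`. -/
def eps (k : ℕ) : ℝ := 1 / 2 ^ (k + 1)

/-- The unnormalized bump function of radius `ε_k`. -/
def bump (k : ℕ) (x : ℝ) : ℝ :=
  if |x| < eps k then Real.exp (eps k ^ 2 / (|x| ^ 2 - eps k ^ 2)) else 0

/-- The mollifier `f_k = c_k · bump`, of integral one. -/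
def mollifier (k : ℕ) (x : ℝ) : ℝ := (∫ z, bump k z)⁻¹ * bump k x

/-- `χ_k = f_k * h_k`. -/
def chi (k : ℕ) (x : ℝ) : ℂ := ∫ z, (mollifier k (x - z) : ℂ) * hk k z

/-- `∫ e^{iz} f_k(z) dz`. -/
def alpha (k : ℕ) : ℂ := ∫ z : ℝ, Complex.exp (Complex.I * z) * (mollifier k z : ℂ)

/-- The smooth function `ξ_k(x) = χ_k(-x) / (n h_k(0) α_k)`; it equals `e^{ix} / n` for
`|x| ≤ ε_k`, see `xi_eq`. -/
def xi (n k : ℕ) (x : ℝ) : ℂ := ((n : ℂ) * hk k 0 * alpha k)⁻¹ * chi k (-x)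

/-! Basic facts: the value of `h`, boundedness and measurability of `ξ_k`. -/

lemma norm_g (a x y : ℝ) : ‖g a x y‖ = Real.exp (-Real.cos (a * x) * y ^ a) := by
  rw [g, Complex.norm_exp]
  congr 1
  rw [mul_comm Complex.I, Complex.neg_re, Complex.re_ofReal_mul, Complex.exp_ofReal_mul_I_re]
  ring

lemma cos_pos_of_abs_lt {a x : ℝ} (ha : 0 < a) (hx : |x| < Real.pi / (2 * a)) :
    0 < Real.cos (a * x) := by
  refine Real.cos_pos_of_mem_Ioo (abs_lt.1 ?_)
  rw [abs_mul, abs_of_pos ha]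
  calc a * |x| < a * (Real.pi / (2 * a)) := by gcongr
    _ = Real.pi / 2 := by field_simp

lemma measurable_g (a x : ℝ) : Measurable (g a x) := by
  unfold g; fun_prop

lemma integrableOn_g {a x : ℝ} (ha : 1 < a) (hc : 0 < Real.cos (a * x)) (s : ℝ) (hs : -1 < s) :
    IntegrableOn (fun y : ℝ => ((y ^ s : ℝ) : ℂ) * g a x y) (Set.Ioi 0) := by
  refine (integrableOn_rpow_mul_exp_neg_mul_rpow (p := a) hs (by linarith) hc).mono'
    ?_ ?_
  · exact ((by fun_prop : Measurable fun y : ℝ => ((y ^ s : ℝ) : ℂ)).mul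
      (measurable_g a x)).aestronglyMeasurable
  · refine (ae_restrict_iff' measurableSet_Ioi).2 (Filter.Eventually.of_forall fun y hy => ?_)
    rw [norm_mul, norm_g, Complex.norm_real, Real.norm_of_nonneg (Real.rpow_nonneg (le_of_lt hy) _)]

lemma g_integral_parts {a x : ℝ} (ha : 1 < a) (hc : 0 < Real.cos (a * x)) :
    ∫ y in Set.Ioi (0 : ℝ), -(((y ^ a : ℝ) : ℂ) *
        (Complex.exp (Complex.I * (a * x : ℝ)) * (Complex.I * a))) * g a x y =
      -Complex.I * ∫ y in Set.Ioi (0 : ℝ), g a x y := by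
  have ha0 : (0 : ℝ) < a := by linarith
  set w : ℂ := Complex.exp (Complex.I * (a * x : ℝ)) with hw
  have i0 : IntegrableOn (fun y : ℝ => g a x y) (Set.Ioi 0) := by
    simpa using integrableOn_g ha hc 0 (by norm_num)
  have ia := integrableOn_g ha hc a (by linarith)
  have key : ∫ y in Set.Ioi (0 : ℝ), (g a x y + (-(a * w)) * (((y ^ a : ℝ) : ℂ) * g a x y)) =
      0 - ((0 : ℝ) : ℂ) * g a x 0 := by
    refine integral_Ioi_of_hasDerivAt_of_tendsto' (f := fun y : ℝ => (y : ℂ) * g a x y) ?_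
      (i0.add (ia.const_mul _)) ?_
    · intro y hy
      have hy0 : (0 : ℝ) ≤ y := hy
      have d1 : HasDerivAt (fun y : ℝ => ((y ^ a : ℝ) : ℂ)) ((a * y ^ (a - 1) : ℝ) : ℂ) y :=
        (Real.hasDerivAt_rpow_const (Or.inr ha.le)).ofReal_comp
      have d2 : HasDerivAt (fun y : ℝ => g a x y)
          (g a x y * (-(((a * y ^ (a - 1) : ℝ) : ℂ) * w))) y :=
        (d1.mul_const w).neg.cexp
      have d3 := (hasDerivAt_id y).ofReal_comp.mul d2
      refine HasDerivAt.congr_deriv (f := fun y : ℝ => (y : ℂ) * g a x y) d3 ?_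
      have : ((y ^ a : ℝ) : ℂ) = ((y : ℝ) : ℂ) * ((y ^ (a - 1) : ℝ) : ℂ) := by
        rw [← Complex.ofReal_mul]
        congr 1
        rcases hy0.eq_or_lt with rfl | h
        · rw [Real.zero_rpow ha0.ne', zero_mul]
        · rw [Real.rpow_sub_one h.ne']; field_simp
      rw [this]; push_cast; simp only [id]; ring
    · rw [tendsto_zero_iff_norm_tendsto_zero]
      have h1 := (rpow_mul_exp_neg_mul_rpow_isLittleO_exp_neg 1 ha hc).trans_tendsto
        (by
          refine Real.tendsto_exp_atBot.comp ?_
          exact Filter.Tendsto.const_mul_atTop_of_neg (by norm_num) Filter.tendsto_id)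
      refine h1.congr' ?_
      filter_upwards [Filter.eventually_ge_atTop (0 : ℝ)] with y hy
      rw [norm_mul, norm_g, Complex.norm_real, Real.norm_of_nonneg hy, Real.rpow_one]
  rw [integral_add i0 (ia.const_mul _), integral_const_mul] at key
  have e : ∀ y : ℝ, -(((y ^ a : ℝ) : ℂ) * (w * (Complex.I * a))) * g a x y =
      Complex.I * ((-(a * w)) * (((y ^ a : ℝ) : ℂ) * g a x y)) := fun y => by ring
  simp_rw [e]
  rw [integral_const_mul, integral_const_mul]
  simp only [Complex.ofReal_zero, zero_mul, sub_zero] at key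
  linear_combination Complex.I * key

lemma hasDerivAt_g_integral {a x : ℝ} (ha : 1 < a) (hc : 0 < Real.cos (a * x)) :
    HasDerivAt (fun x => ∫ y in Set.Ioi (0 : ℝ), g a x y)
      (-Complex.I * ∫ y in Set.Ioi (0 : ℝ), g a x y) x := by
  have ha0 : (0 : ℝ) < a := by linarith
  rw [← g_integral_parts ha hc]
  have hc2 : 0 < Real.cos (a * x) / 2 := by linarith
  refine (hasDerivAt_integral_of_dominated_loc_of_deriv_le
    (s := {z | Real.cos (a * x) / 2 < Real.cos (a * z)})
    (bound := fun y => a * (y ^ a * Real.exp (-(Real.cos (a * x) / 2) * y ^ a)))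
    (F' := fun x y => -(((y ^ a : ℝ) : ℂ) *
        (Complex.exp (Complex.I * (a * x : ℝ)) * (Complex.I * a))) * g a x y)
    ?_ ?_ ?_ ?_ ?_ ?_ ?_).2
  · exact (isOpen_lt continuous_const (by fun_prop)).mem_nhds (by simp; linarith)
  · exact Filter.Eventually.of_forall fun z => (measurable_g a z).aestronglyMeasurable
  · have := integrableOn_g ha hc 0 (by norm_num)
    simp only [Real.rpow_zero, Complex.ofReal_one, one_mul] at this
    exact this
  · exact (Measurable.mul (by fun_prop) (measurable_g a x)).aestronglyMeasurable
  · refine (ae_restrict_iff' measurableSet_Ioi).2 (Filter.Eventually.of_forall fun y hy z hz => ?_)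
    have hy0 : (0 : ℝ) < y := hy
    have hp := Real.rpow_pos_of_pos hy0 a
    have hz' : Real.cos (a * x) / 2 < Real.cos (a * z) := hz
    rw [norm_mul, norm_g, norm_neg, norm_mul, norm_mul, norm_mul, Complex.norm_real,
      mul_comm Complex.I (((a * z : ℝ)) : ℂ), Complex.norm_exp_ofReal_mul_I, Complex.norm_I,
      Complex.norm_real, Real.norm_of_nonneg hp.le, Real.norm_of_nonneg ha0.le, one_mul, one_mul,
      mul_comm (y ^ a) a, mul_assoc]
    gcongr
  · exact (integrableOn_rpow_mul_exp_neg_mul_rpow (by linarith) ha0 hc2).const_mul a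
  · refine Filter.Eventually.of_forall fun y z _ => ?_
    have d1 : HasDerivAt (fun z : ℝ => Complex.I * (a * z : ℝ)) (Complex.I * a) z := by
      have := ((hasDerivAt_id z).const_mul a).ofReal_comp.const_mul Complex.I
      simpa using this
    have d2 := ((d1.cexp).const_mul (((y ^ a : ℝ)) : ℂ)).neg.cexp
    refine HasDerivAt.congr_deriv (f := fun z : ℝ => g a z y) d2 ?_
    rw [mul_comm]; rfl

lemma g_integral {a x : ℝ} (ha : 1 < a) (hx : |x| < Real.pi / (2 * a)) :
    ∫ y in Set.Ioi (0 : ℝ), g a x y =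
      (Real.Gamma (1 / a + 1) : ℂ) * Complex.exp (-(Complex.I * x)) := by
  have ha0 : (0 : ℝ) < a := by linarith
  set r := Real.pi / (2 * a) with hr
  have hr0 : 0 < r := by positivity
  have hd : ∀ z ∈ Set.Ioo (-r) r, HasDerivAt
      (fun x : ℝ => (∫ y in Set.Ioi (0 : ℝ), g a x y) * Complex.exp (Complex.I * x)) 0 z := by
    intro z hz
    have hc := cos_pos_of_abs_lt ha0 (abs_lt.2 hz)
    have d1 : HasDerivAt (fun z : ℝ => Complex.I * (z : ℂ)) Complex.I z := by
      simpa using (hasDerivAt_id z).ofReal_comp.const_mul Complex.I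
    refine ((hasDerivAt_g_integral ha hc).mul d1.cexp).congr_deriv ?_
    ring
  have hconst := isOpen_Ioo.is_const_of_deriv_eq_zero (convex_Ioo (-r) r).isPreconnected
    (fun z hz => (hd z hz).differentiableAt.differentiableWithinAt)
    (fun z hz => (hd z hz).deriv) (abs_lt.1 hx) (show (0 : ℝ) ∈ Set.Ioo (-r) r by simp [hr0])
  have h0 : ∫ y in Set.Ioi (0 : ℝ), g a 0 y = (Real.Gamma (1 / a + 1) : ℂ) := by
    rw [← integral_exp_neg_rpow ha0, ← integral_complex_ofReal]
    simp [g]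
  simp only [h0, Complex.ofReal_zero, mul_zero, Complex.exp_zero, mul_one] at hconst
  rw [← hconst, mul_assoc, ← Complex.exp_add]
  simp

lemma one_lt_expo (k : ℕ) : 1 < expo k := by
  have h1 : (1 : ℝ) ≤ 2 ^ k := one_le_pow₀ (by norm_num)
  have h2 := Real.pi_gt_three
  unfold expo
  nlinarith

lemma hk_radius (k : ℕ) : Real.pi / (2 * expo k) = 2 * eps k := by
  unfold expo eps
  have := Real.pi_pos
  field_simp
  ring

lemma eps_pos (k : ℕ) : 0 < eps k := by unfold eps; positivity

lemma eps_le (k : ℕ) : eps k ≤ 1 / 2 := by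
  unfold eps
  have : (1 : ℝ) ≤ 2 ^ k := one_le_pow₀ (by norm_num)
  rw [pow_succ]
  exact one_div_le_one_div_of_le (by norm_num) (by linarith)

lemma hk_eq (k : ℕ) (x : ℝ) : hk k x = if |x| < 2 * eps k then
    (Real.Gamma (1 / expo k + 1) : ℂ) * Complex.exp (-(Complex.I * x)) else 0 := by
  unfold hk h
  rw [hk_radius]
  split_ifs with hx
  · exact g_integral (one_lt_expo k) (by rwa [hk_radius])
  · rfl

lemma hk_zero (k : ℕ) : hk k 0 = (Real.Gamma (1 / expo k + 1) : ℂ) := by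
  rw [hk_eq, if_pos (by simpa using eps_pos k)]; simp

lemma gamma_pos (k : ℕ) : 0 < Real.Gamma (1 / expo k + 1) := by
  have := one_lt_expo k
  exact Real.Gamma_pos_of_pos (by positivity)

lemma hk_zero_ne (k : ℕ) : hk k 0 ≠ 0 := by
  rw [hk_zero]; exact_mod_cast (gamma_pos k).ne'

lemma measurable_hk (k : ℕ) : Measurable (hk k) := by
  rw [funext (hk_eq k)]
  exact Measurable.ite (measurableSet_lt (by fun_prop) measurable_const) (by fun_prop)
    measurable_const

lemma norm_hk_le (k : ℕ) (x : ℝ) : ‖hk k x‖ ≤ ‖hk k 0‖ := by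
  rw [hk_eq k x]
  split_ifs
  · have e : -(Complex.I * (x : ℂ)) = ((-x : ℝ) : ℂ) * Complex.I := by push_cast; ring
    rw [norm_mul, e, Complex.norm_exp_ofReal_mul_I, mul_one, hk_zero]
  · simp

lemma bump_eq (k : ℕ) (x : ℝ) :
    bump k x = expNegInvGlue ((eps k ^ 2 - x ^ 2) / eps k ^ 2) := by
  have he := eps_pos k
  unfold bump expNegInvGlue
  by_cases hx : |x| < eps k
  · have h2 : x ^ 2 < eps k ^ 2 := by
      rw [← sq_abs]; exact pow_lt_pow_left₀ hx (abs_nonneg x) (by norm_num)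
    have h3 : 0 < eps k ^ 2 - x ^ 2 := by linarith
    rw [if_pos hx, if_neg (not_le.2 (by positivity)), sq_abs, inv_div, ← div_neg, neg_sub]
  · have h2 : eps k ^ 2 ≤ x ^ 2 := by
      rw [← sq_abs x]; exact pow_le_pow_left₀ he.le (not_lt.1 hx) 2
    rw [if_neg hx, if_pos (div_nonpos_of_nonpos_of_nonneg (by linarith) (by positivity))]

lemma continuous_bump (k : ℕ) : Continuous (bump k) := by
  rw [funext (bump_eq k)]
  exact (expNegInvGlue.contDiff (n := 0)).continuous.comp (by fun_prop)

lemma bump_nonneg (k : ℕ) (x : ℝ) : 0 ≤ bump k x := by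
  rw [bump_eq]; exact expNegInvGlue.nonneg _

lemma bump_zero_of_le {k : ℕ} {x : ℝ} (hx : eps k ≤ |x|) : bump k x = 0 := if_neg (not_lt.2 hx)

lemma hasCompactSupport_bump (k : ℕ) : HasCompactSupport (bump k) :=
  HasCompactSupport.intro (isCompact_Icc (a := -eps k) (b := eps k)) fun x hx =>
    bump_zero_of_le (by
      by_contra hlt
      exact hx (Set.Ioo_subset_Icc_self (abs_lt.1 (not_le.1 hlt))))

lemma integrable_bump (k : ℕ) : Integrable (bump k) :=
  (continuous_bump k).integrable_of_hasCompactSupport (hasCompactSupport_bump k)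

lemma integral_bump_pos (k : ℕ) : 0 < ∫ z, bump k z :=
  (continuous_bump k).integral_pos_of_hasCompactSupport_nonneg_nonzero (x := 0)
    (hasCompactSupport_bump k) (bump_nonneg k) (by
      rw [bump, if_pos (by simpa using eps_pos k)]; exact (Real.exp_pos _).ne')

lemma mollifier_nonneg (k : ℕ) (x : ℝ) : 0 ≤ mollifier k x :=
  mul_nonneg (inv_nonneg.2 (integral_bump_pos k).le) (bump_nonneg k x)

lemma integrable_mollifier (k : ℕ) : Integrable (mollifier k) := (integrable_bump k).const_mul _

lemma integral_mollifier (k : ℕ) : ∫ z, mollifier k z = 1 := by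
  unfold mollifier
  rw [integral_const_mul, inv_mul_cancel₀ (integral_bump_pos k).ne']

lemma continuous_mollifier (k : ℕ) : Continuous (mollifier k) :=
  continuous_const.mul (continuous_bump k)

lemma mollifier_zero_of_le {k : ℕ} {x : ℝ} (hx : eps k ≤ |x|) : mollifier k x = 0 := by
  rw [mollifier, bump_zero_of_le hx, mul_zero]

lemma norm_alpha_ge (k : ℕ) : 1 / 2 ≤ ‖alpha k‖ := by
  refine le_trans ?_ (Complex.re_le_norm _)
  have hint : Integrable fun z : ℝ => Complex.exp (Complex.I * z) * (mollifier k z : ℂ) := by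
    refine (integrable_mollifier k).mono (by
      have := continuous_mollifier k
      exact (by fun_prop : Continuous _).aestronglyMeasurable)
      (Filter.Eventually.of_forall fun z => ?_)
    rw [norm_mul, mul_comm Complex.I, Complex.norm_exp_ofReal_mul_I, one_mul, Complex.norm_real]
  have hre : (alpha k).re = ∫ z : ℝ, Real.cos z * mollifier k z := by
    have := (Complex.reCLM.integral_comp_comm hint).symm
    simp only [Complex.reCLM_apply] at this
    rw [alpha, this]
    refine integral_congr_ae (Filter.Eventually.of_forall fun z => ?_)
    simp only
    rw [mul_comm, Complex.re_ofReal_mul, mul_comm Complex.I, Complex.exp_ofReal_mul_I_re, mul_comm]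
  have hint' : Integrable fun z : ℝ => Real.cos z * mollifier k z := by
    refine (integrable_mollifier k).mono (by
      have := continuous_mollifier k
      exact (by fun_prop : Continuous _).aestronglyMeasurable)
      (Filter.Eventually.of_forall fun z => ?_)
    rw [norm_mul]
    exact mul_le_of_le_one_left (norm_nonneg _) (Real.abs_cos_le_one z)
  calc (1 / 2 : ℝ) = ∫ z, 1 / 2 * mollifier k z := by
        rw [integral_const_mul, integral_mollifier, mul_one]
    _ ≤ ∫ z, Real.cos z * mollifier k z := by
        refine integral_mono ((integrable_mollifier k).const_mul _) hint' fun z => ?_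
        by_cases hz : eps k ≤ |z|
        · simp [mollifier_zero_of_le hz]
        · refine mul_le_mul_of_nonneg_right ?_ (mollifier_nonneg k z)
          have h1 : |z| ≤ 1 / 2 := (not_le.1 hz).le.trans (eps_le k)
          have h2 := Real.one_sub_sq_div_two_le_cos (x := z)
          have h3 := abs_le.1 h1
          nlinarith
    _ = (alpha k).re := hre.symm

lemma alpha_ne (k : ℕ) : alpha k ≠ 0 := by
  intro h0
  have := norm_alpha_ge k
  rw [h0, norm_zero] at this
  linarith

lemma norm_chi_le (k : ℕ) (x : ℝ) : ‖chi k x‖ ≤ ‖hk k 0‖ := by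
  calc ‖chi k x‖ ≤ ∫ z, mollifier k (x - z) * ‖hk k 0‖ := by
        refine norm_integral_le_of_norm_le
          (((integrable_mollifier k).comp_sub_left x).mul_const _)
          (Filter.Eventually.of_forall fun z => ?_)
        rw [norm_mul, Complex.norm_real, Real.norm_of_nonneg (mollifier_nonneg k _)]
        exact mul_le_mul_of_nonneg_left (norm_hk_le k z) (mollifier_nonneg k _)
    _ = ‖hk k 0‖ := by
        rw [integral_mul_const, integral_sub_left_eq_self (mollifier k) volume x,
          integral_mollifier, one_mul]

lemma measurable_chi (k : ℕ) : Measurable (chi k) := by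
  have hm : Measurable fun p : ℝ × ℝ => (mollifier k (p.1 - p.2) : ℂ) * hk k p.2 := by
    have h1 := (continuous_mollifier k).measurable
    have h2 := measurable_hk k
    fun_prop
  exact (hm.stronglyMeasurable.integral_prod_right (ν := volume)).measurable

lemma measurable_xi (n k : ℕ) : Measurable (xi n k) :=
  measurable_const.mul ((measurable_chi k).comp measurable_neg)

lemma norm_xi_le (n k : ℕ) (x : ℝ) : ‖xi n k x‖ ≤ 2 := by
  have h0 : 0 < ‖hk k 0‖ := norm_pos_iff.2 (hk_zero_ne k)
  have hα := norm_alpha_ge k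
  rcases Nat.eq_zero_or_pos n with rfl | hn
  · simp [xi]
  have hn1 : (1 : ℝ) ≤ n := by exact_mod_cast hn
  rw [xi, norm_mul, norm_inv, norm_mul, norm_mul, Complex.norm_natCast,
    inv_mul_le_iff₀ (by positivity)]
  refine (norm_chi_le k _).trans ?_
  calc ‖hk k 0‖ = 1 * ‖hk k 0‖ * (1 / 2) * 2 := by ring
    _ ≤ n * ‖hk k 0‖ * ‖alpha k‖ * 2 := by gcongr

/-- On `[-ε_k, ε_k]` the function `ξ_k` is `e^{ix} / n`. -/
lemma xi_eq {n k : ℕ} {x : ℝ} (hx : |x| ≤ eps k) :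
    xi n k x = 1 / n * Complex.exp (Complex.I * x) := by
  have hchi : chi k (-x) = Complex.exp (Complex.I * x) * hk k 0 * alpha k := by
    have h1 : chi k (-x) = ∫ z : ℝ, (mollifier k z : ℂ) * hk k (-x - z) := by
      rw [chi, ← integral_sub_left_eq_self _ volume (-x)]
      simp
    rw [h1, alpha, ← integral_const_mul]
    refine integral_congr_ae (Filter.Eventually.of_forall fun z => ?_)
    simp only
    by_cases hz : eps k ≤ |z|
    · simp [mollifier_zero_of_le hz]
    · have : |-x - z| < 2 * eps k := by
        have := abs_sub (-x) z
        rw [abs_neg] at this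
        linarith [not_le.1 hz]
      rw [hk_eq k (-x - z), if_pos this, hk_zero]
      have e : -(Complex.I * ((-x - z : ℝ) : ℂ)) = Complex.I * x + Complex.I * z := by
        push_cast; ring
      rw [e, Complex.exp_add]; ring
  have h0 := hk_zero_ne k
  have hα := alpha_ne k
  rw [xi, hchi]
  field_simp

/-! ### The space `SD²` built from a sequence of test fields -/

/-- A uniformly bounded sequence of measurable fields `E_m : ℝⁿ → ℂ^d`. -/
structure TestFields (n d : ℕ) where
  E : ℕ → (Fin n → ℝ) → Fin d → ℂ
  measurable : ∀ m j, Measurable fun x => E m x j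
  bounded : ∃ M : ℝ, ∀ m x j, ‖E m x j‖ ≤ M

/-- `L¹(ℝⁿ; ℂ^d)`. -/
abbrev VectorL1 (n d : ℕ) : Type :=
  Lp (EuclideanSpace ℂ (Fin d)) 1 (volume : Measure (Fin n → ℝ))

/-- The weights `t_m = 2^{-m}`, `m ≥ 1` (the index `m` of the code is `m - 1` on paper). -/
def weight (m : ℕ) : ℝ := (1 / 2) ^ (m + 1)

namespace TestFields

variable {n d : ℕ} (T : TestFields n d)

lemma integrable_mul (m : ℕ) (j : Fin d) (f : VectorL1 n d) :
    Integrable fun x => T.E m x j * f x j := by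
  obtain ⟨M, hM⟩ := T.bounded
  have h1 : Integrable (fun x => f x j) := by
    have := (L1.integrable_coeFn f)
    exact (EuclideanSpace.proj j : EuclideanSpace ℂ (Fin d) →L[ℂ] ℂ).integrable_comp this
  exact h1.bdd_mul (T.measurable m j).aestronglyMeasurable
    (Filter.Eventually.of_forall fun x => hM m x j)

/-- The functional `F_m(f) = ∫ E_m · f` on `L¹(ℝⁿ; ℂ^d)`. -/
def F (m : ℕ) : VectorL1 n d →ₗ[ℂ] ℂ where
  toFun f := ∫ x, ∑ j, T.E m x j * f x j
  map_add' f f' := by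
    rw [← integral_add (integrable_finsetSum _ fun j _ => T.integrable_mul m j f)
      (integrable_finsetSum _ fun j _ => T.integrable_mul m j f')]
    refine integral_congr_ae ?_
    filter_upwards [Lp.coeFn_add f f'] with x hx
    rw [hx]
    simp [mul_add, Finset.sum_add_distrib]
  map_smul' c f := by
    rw [RingHom.id_apply, smul_eq_mul, ← integral_const_mul]
    refine integral_congr_ae ?_
    filter_upwards [Lp.coeFn_smul c f] with x hx
    rw [hx]
    simp [Finset.mul_sum, mul_left_comm]

lemma F_bounded (f : VectorL1 n d) : ∃ B : ℝ, ∀ m, ‖T.F m f‖ ≤ B := by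
  obtain ⟨M, hM⟩ := T.bounded
  refine ⟨∫ x, ∑ j, M * ‖f x j‖, fun m => ?_⟩
  have h1 : ∀ j, Integrable (fun x => M * ‖f x j‖) := fun j =>
    ((EuclideanSpace.proj j : EuclideanSpace ℂ (Fin d) →L[ℂ] ℂ).integrable_comp
      (L1.integrable_coeFn f)).norm.const_mul M
  refine norm_integral_le_of_norm_le (integrable_finsetSum _ fun j _ => h1 j)
    (Filter.Eventually.of_forall fun x => ?_)
  refine (norm_sum_le _ _).trans (Finset.sum_le_sum fun j _ => ?_)
  rw [norm_mul]
  exact mul_le_mul_of_nonneg_right (hM m x j) (norm_nonneg _)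

end TestFields

lemma weight_pos (m : ℕ) : 0 < weight m := by unfold weight; positivity

lemma summable_weight : Summable weight := by
  unfold weight
  exact (summable_nat_add_iff 1).2 (summable_geometric_of_lt_one (by norm_num) (by norm_num))

/-- `L¹(ℝⁿ; ℂ^d)`, to be equipped with the `SD²` inner product. -/
def PreSD {n d : ℕ} (_T : TestFields n d) : Type := VectorL1 n d

namespace PreSD

variable {n d : ℕ} (T : TestFields n d)

instance : AddCommGroup (PreSD T) := inferInstanceAs (AddCommGroup (VectorL1 n d))

instance : Module ℂ (PreSD T) := inferInstanceAs (Module ℂ (VectorL1 n d))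

/-- `F_m`, on `PreSD T`. -/
def F (m : ℕ) : PreSD T →ₗ[ℂ] ℂ := T.F m

lemma summable_inner (f f' : PreSD T) :
    Summable fun m => (weight m : ℂ) * (F T m f' * starRingEnd ℂ (F T m f)) := by
  obtain ⟨B, hB⟩ := T.F_bounded f
  obtain ⟨B', hB'⟩ := T.F_bounded f'
  refine Summable.of_norm_bounded (summable_weight.mul_right (B' * B)) fun m => ?_
  rw [norm_mul, norm_mul, Complex.norm_real, Real.norm_of_nonneg (weight_pos m).le,
    RCLike.norm_conj]
  exact mul_le_mul_of_nonneg_left (mul_le_mul (hB' m) (hB m) (norm_nonneg _)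
    ((norm_nonneg _).trans (hB' m))) (weight_pos m).le

/-- The inner product `(f', f) = ∑_m t_m F_m(f') conj(F_m(f))`, written as
`inner ℂ f f'` (Mathlib's inner products are conjugate linear in the first variable). -/
instance core : PreInnerProductSpace.Core ℂ (PreSD T) where
  inner f f' := ∑' m, (weight m : ℂ) * (F T m f' * starRingEnd ℂ (F T m f))
  conj_inner_symm f f' := by
    rw [Complex.conj_tsum]
    refine tsum_congr fun m => ?_
    simp [mul_comm]
  re_inner_nonneg f := by
    rw [RCLike.re_eq_complex_re, Complex.re_tsum (summable_inner T f f)]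
    refine tsum_nonneg fun m => ?_
    rw [Complex.mul_conj, ← Complex.ofReal_mul, Complex.ofReal_re]
    exact mul_nonneg (weight_pos m).le (Complex.normSq_nonneg _)
  add_left f f' k := by
    rw [← (summable_inner T f k).tsum_add (summable_inner T f' k)]
    refine tsum_congr fun m => ?_
    simp only [map_add]; ring
  smul_left f f' c := by
    rw [← tsum_mul_left]
    refine tsum_congr fun m => ?_
    simp only [map_smul, smul_eq_mul, map_mul]; ring

instance : SeminormedAddCommGroup (PreSD T) :=
  InnerProductSpace.Core.toSeminormedAddCommGroup (𝕜 := ℂ)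

instance : InnerProductSpace ℂ (PreSD T) := InnerProductSpace.ofCore (core T)

lemma norm_sq (f : PreSD T) : ‖f‖ ^ 2 = ∑' m, weight m * ‖F T m f‖ ^ 2 := by
  rw [norm_sq_eq_re_inner (𝕜 := ℂ) f]
  change (∑' m, (weight m : ℂ) * (F T m f * starRingEnd ℂ (F T m f))).re = _
  rw [Complex.re_tsum (summable_inner T f f)]
  refine tsum_congr fun m => ?_
  rw [Complex.mul_conj, ← Complex.ofReal_mul, Complex.ofReal_re, Complex.normSq_eq_norm_sq]

lemma norm_F_le (m : ℕ) (f : PreSD T) : ‖F T m f‖ ≤ Real.sqrt ((weight m)⁻¹) * ‖f‖ := by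
  have hs : Summable fun m => weight m * ‖F T m f‖ ^ 2 := by
    have := Complex.reCLM.summable (summable_inner T f f)
    refine this.congr fun m => ?_
    rw [Complex.reCLM_apply, Complex.mul_conj, ← Complex.ofReal_mul, Complex.ofReal_re,
      Complex.normSq_eq_norm_sq]
  have h1 : weight m * ‖F T m f‖ ^ 2 ≤ ‖f‖ ^ 2 := by
    rw [norm_sq]
    exact hs.le_tsum m fun i _ => mul_nonneg (weight_pos i).le (sq_nonneg _)
  have hw := weight_pos m
  refine (sq_le_sq₀ (norm_nonneg _) (by positivity)).1 ?_
  rw [mul_pow, Real.sq_sqrt (by positivity), inv_mul_eq_div, le_div_iff₀ hw]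
  linarith

/-- `F_m` as a continuous functional for the `SD²` norm. -/
def FCont (m : ℕ) : PreSD T →L[ℂ] ℂ :=
  (F T m).mkContinuous (Real.sqrt ((weight m)⁻¹)) (norm_F_le T m)

end PreSD

/-- The Hilbert space `SD²`: the completion of `L¹` for the inner product
`∑_m t_m F_m(f) conj(F_m(f'))`. -/
abbrev SD2 {n d : ℕ} (T : TestFields n d) : Type := UniformSpace.Completion (PreSD T)

/-- The continuous extension of `F_m` to `SD²`. -/
def SD2.F {n d : ℕ} (T : TestFields n d) (m : ℕ) : SD2 T →L[ℂ] ℂ :=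
  (PreSD.FCont T m).fromCompletion

/-- The element `u` of `SD²` is the function `f`: for every `m` the function `E_m · f` is
Henstock–Kurzweil integrable over `ℝⁿ`, with integral `F_m(u)`. -/
def Represents {n d : ℕ} (T : TestFields n d) (f : (Fin n → ℝ) → Fin d → ℂ) (u : SD2 T) : Prop :=
  ∀ m, HasHKIntegral (fun x => ∑ j, T.E m x j * f x j) (SD2.F T m u)

/-! ### The Jones fields on `ℝⁿ`

The enumeration `σ` lists the pairs `(k - 1, q)`, with `k ≥ 1` and `q ∈ ℚⁿ`. -/

open Classical in
/-- The vector-valued Jones fields: for `m = (k, q)`, `E_m(x) = (ξ_k(x₁ - q₁), …, ξ_k(xₙ - qₙ))` on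
the closed cube with centre `q` and edge `2 ε_k = 2^{-k}`, and `E_m(x) = 0` off this cube. -/
def vectorFields (n : ℕ) (σ : ℕ ≃ ℕ × (Fin n → ℚ)) : TestFields n n where
  E m x j :=
    if ∀ l, |x l - ((σ m).2 l : ℝ)| ≤ eps ((σ m).1 + 1) then
      xi n ((σ m).1 + 1) (x j - ((σ m).2 j : ℝ)) else 0
  measurable m j := by
    refine Measurable.ite ?_ ((measurable_xi n _).comp (by fun_prop)) measurable_const
    rw [Set.ofPred_forall]
    exact MeasurableSet.iInter fun l => measurableSet_le (by fun_prop) measurable_const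
  bounded := ⟨2, fun m x j => by
    split_ifs
    · exact norm_xi_le _ _ _
    · simp⟩

/-- The smooth compactly supported scalar Jones functions: for `m = (k, q)`,
`E_m(x) = ξ_k(x₁ - q₁) ⋯ ξ_k(xₙ - qₙ)`. -/
def scalarFields (n : ℕ) (σ : ℕ ≃ ℕ × (Fin n → ℚ)) : TestFields n 1 where
  E m x _ := ∏ l, xi n ((σ m).1 + 1) (x l - ((σ m).2 l : ℝ))
  measurable m _ := Finset.measurable_prod _ fun l _ =>
    (measurable_xi n _).comp (by fun_prop)
  bounded := ⟨2 ^ n, fun m x _ => by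
    rw [norm_prod]
    refine (Finset.prod_le_prod (fun _ _ => norm_nonneg _) fun l _ =>
      norm_xi_le n _ _).trans ?_
    simp⟩

end Jones

end

namespace Jones

open Set Filter Topology

/-! ### Gauges and Cousin's lemma on `[-∞, ∞]ⁿ` -/

/-! Each component `E` of a Jones field has bounded variation in a product sense: off finitely many
hyperplanes `x i = b i` it is a superposition `E(x) = ∫ 1_{x ≤ t} ρ(t) dν(t)` of indicators of lower
orthants, with `∫ ‖ρ‖ dν ≤ 14 ^ n` whatever `k` and `q` are (`TailRep`, `vectorFieldsRep`,
`scalarFieldsRep`). If `Φ` is the primitive of an HK-integrable `f`, exchanging the two integrations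
suggests `∫ E f = ∫ ρ Φ dν`, which is at most `14 ^ n` times the Alexiewicz norm. This integration
by parts is `TailRep.hasHKIntegral_mul`.

The exchange is legitimate because one gauge makes the Riemann sums of all truncations `1_{x ≤ a} f`
close to `Φ a`, uniformly in `a` (`HKIntegrable.exists_gauge`). The uniformity has two sources.
First, the part of a cell below `a` may miss the tag, but it is a signed combination of `2 ^ n`
subcells, each containing the tag or degenerate; a Saks–Henstock argument then compares any two fine
partitions truncated at `a` (`TaggedPartition.norm_sumBelow_sub_sumBelow_le`). Second, a gauge that
does not depend on `a` makes the cells meeting the hyperplanes `x i = a i` contribute little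
(`exists_gauge_sum_meets_le`).

The step function attached to a fine partition is in `L¹`, and its primitive is uniformly close to
`Φ`; hence its integrals against all the `E_m` are simultaneously close to the required values
(`exists_step_approx`). The weights have sum one, so the `SD²` norm is at most the supremum of the
`|F_m|`: the step functions are Cauchy and their limit is `u` (`SD2.exists_of_approx`). Uniqueness
holds because the `F_m` separate the points of `SD²` (`SD2.ext_of_F`) and HK integrals are unique.
-/

/-- A gauge on `[-∞, ∞]ⁿ`: an open neighbourhood of each point. -/
def IsGauge {n : ℕ} (γ : (Fin n → EReal) → Set (Fin n → EReal)) : Prop :=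
  ∀ x, IsOpen (γ x) ∧ x ∈ γ x

lemma IsGauge.inter {n : ℕ} {γ δ : (Fin n → EReal) → Set (Fin n → EReal)}
    (hγ : IsGauge γ) (hδ : IsGauge δ) : IsGauge fun x => γ x ∩ δ x :=
  fun x => ⟨(hγ x).1.inter (hδ x).1, (hγ x).2, (hδ x).2⟩

lemma TaggedPartition.IsFine.mono {n : ℕ} {γ δ : (Fin n → EReal) → Set (Fin n → EReal)}
    {P : TaggedPartition n} (hP : P.IsFine γ) (h : ∀ x, γ x ⊆ δ x) : P.IsFine δ :=
  fun c hc => (hP c hc).trans (h _)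

/-- The open side of `q` in direction `p.1` avoids the value `p.2`, for every `p ∈ G`. -/
def Cell.AvoidsGrid {n : ℕ} (q : Cell n) (G : Finset (Fin n × EReal)) : Prop :=
  ∀ p ∈ G, p.2 ≤ q.lower p.1 ∨ q.upper p.1 ≤ p.2

/-- An order isomorphism of `[-∞, ∞]` and `[0, 1]`. -/
noncomputable def unitIso : EReal ≃o Icc (0 : ℝ) 1 :=
  ENNReal.logOrderIso.symm.trans ENNReal.orderIsoUnitIntervalBirational

/-- The inverse of `unitIso`, constant on each side of `[0, 1]`. -/
noncomputable def fromUnit (t : ℝ) : EReal := unitIso.symm (projIcc 0 1 zero_le_one t)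

lemma continuous_fromUnit : Continuous fromUnit :=
  unitIso.symm.continuous.comp continuous_projIcc

lemma fromUnit_unitIso (x : EReal) : fromUnit (unitIso x) = x := by
  simp [fromUnit]

lemma unitIso_fromUnit {t : ℝ} (ht : t ∈ Icc (0 : ℝ) 1) : (unitIso (fromUnit t) : ℝ) = t := by
  simp [fromUnit, projIcc_of_mem _ ht]

lemma monotone_fromUnit : Monotone fromUnit :=
  unitIso.symm.monotone.comp (monotone_projIcc _)

/-- The unit box of `ℝⁿ`. -/
def unitBox (n : ℕ) : BoxIntegral.Box (Fin n) := ⟨fun _ => 0, fun _ => 1, fun _ => zero_lt_one⟩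

/-- This is Cousin's lemma, transported from the unit cube by an order isomorphism in each
coordinate. The subordinate partition refines one already split along the images of the values in
`G`, which makes every cell avoid `G`. -/
lemma exists_isFine {n : ℕ} {γ : (Fin n → EReal) → Set (Fin n → EReal)} (hγ : IsGauge γ)
    (G : Finset (Fin n × EReal)) :
    ∃ P : TaggedPartition n, P.IsFine γ ∧ ∀ c ∈ P.cells, c.AvoidsGrid G := by
  classical
  have hcont : Continuous fun (y : Fin n → ℝ) i => fromUnit (y i) :=
    continuous_pi fun i => continuous_fromUnit.comp (continuous_apply i)
  have hr : ∀ y : Fin n → ℝ, ∃ r : Ioi (0 : ℝ),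
      Metric.closedBall y r ⊆ (fun (y : Fin n → ℝ) i => fromUnit (y i)) ⁻¹'
        γ fun i => fromUnit (y i) := fun y => by
    obtain ⟨r, hr, h⟩ := Metric.nhds_basis_closedBall.mem_iff.1
      (((hγ fun i => fromUnit (y i)).1.preimage hcont).mem_nhds (hγ _).2)
    exact ⟨⟨r, hr⟩, h⟩
  choose r hr using hr
  set S : Finset (Fin n × ℝ) := G.image fun p => (p.1, (unitIso p.2 : ℝ)) with hS
  obtain ⟨π, hle, hH, hsub, -, hU⟩ :=
    BoxIntegral.Prepartition.exists_tagged_le_isHenstock_isSubordinate_iUnion_eq r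
      (BoxIntegral.Prepartition.splitMany (unitBox n) S)
  have hpart : π.toPrepartition.IsPartition := by
    rw [BoxIntegral.Prepartition.isPartition_iff_iUnion_eq]
    exact hU.trans (BoxIntegral.Prepartition.isPartition_iff_iUnion_eq.1
      (BoxIntegral.Prepartition.isPartition_splitMany _ _))
  have hJ : ∀ J ∈ π.boxes, ∀ i, 0 ≤ J.lower i ∧ J.lower i < J.upper i ∧ J.upper i ≤ 1 := by
    intro J hJ i
    have h := BoxIntegral.Box.le_iff_bounds.1 (π.toPrepartition.le_of_mem hJ)
    exact ⟨h.1 i, J.lower_lt_upper i, h.2 i⟩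
  have hlt : ∀ {s t : ℝ}, 0 ≤ s → s < t → t ≤ 1 → fromUnit s < fromUnit t := by
    intro s t h0 h h1
    refine unitIso.symm.strictMono ?_
    rw [projIcc_of_mem _ ⟨h0, h.le.trans h1⟩, projIcc_of_mem _ ⟨h0.trans h.le, h1⟩]
    exact h
  have hlow : ∀ {s : ℝ} {y : EReal}, 0 ≤ s → s ≤ 1 → (fromUnit s < y ↔ s < unitIso y) := by
    intro s y h0 h1
    rw [← unitIso.lt_iff_lt, ← Subtype.coe_lt_coe, unitIso_fromUnit ⟨h0, h1⟩]
  have hupp : ∀ {s : ℝ} {y : EReal}, 0 ≤ s → s ≤ 1 → (y < fromUnit s ↔ unitIso y < s) := by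
    intro s y h0 h1
    rw [← unitIso.lt_iff_lt, ← Subtype.coe_lt_coe, unitIso_fromUnit ⟨h0, h1⟩]
  let cell : BoxIntegral.Box (Fin n) → Cell n := fun J =>
    ⟨fun i => fromUnit (π.tag J i), fun i => fromUnit (J.lower i), fun i => fromUnit (J.upper i)⟩
  have hmem : ∀ J ∈ π.boxes, ∀ y ∈ BoxIntegral.Box.Icc J,
      (fun i => fromUnit (y i)) ∈ Icc (cell J).lower (cell J).upper := fun J _ y hy =>
    ⟨fun i => monotone_fromUnit (hy.1 i), fun i => monotone_fromUnit (hy.2 i)⟩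
  refine ⟨⟨π.boxes.image cell, ?_, ?_, ?_, ?_⟩, ?_, ?_⟩
  · rintro c hc i
    obtain ⟨J, h, rfl⟩ := Finset.mem_image.1 hc
    obtain ⟨h0, h1, h2⟩ := hJ J h i
    exact hlt h0 h1 h2
  · rintro c hc
    obtain ⟨J, h, rfl⟩ := Finset.mem_image.1 hc
    exact hmem J h _ (hH J h)
  · rintro c hc c' hc' hne
    obtain ⟨J, h, rfl⟩ := Finset.mem_image.1 hc
    obtain ⟨J', h', rfl⟩ := Finset.mem_image.1 hc'
    have hd := π.pairwiseDisjoint h h' (fun e => hne (by rw [e]))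
    have hd' : ∀ y : Fin n → ℝ, y ∈ J → y ∈ J' → False := fun y hy hy' =>
      disjoint_left.1 hd hy hy'
    refine disjoint_left.2 fun x hx hx' => hd' (fun i => (unitIso (x i) : ℝ)) ?_ ?_
    · intro i
      obtain ⟨h0, h1, h2⟩ := hJ J h i
      exact ⟨(hlow h0 (h1.le.trans h2)).1 (hx i trivial).1,
        ((hupp (h0.trans h1.le) h2).1 (hx i trivial).2).le⟩
    · intro i
      obtain ⟨h0, h1, h2⟩ := hJ J' h' i
      exact ⟨(hlow h0 (h1.le.trans h2)).1 (hx' i trivial).1,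
        ((hupp (h0.trans h1.le) h2).1 (hx' i trivial).2).le⟩
  · intro x
    -- The boxes are half-open and cover only the half-open cube. The finite union of their closures
    -- is closed, so it contains the closed cube.
    have hclosed : IsClosed (⋃ J ∈ π.boxes, BoxIntegral.Box.Icc J) :=
      π.boxes.finite_toSet.isClosed_biUnion fun J _ => BoxIntegral.Box.isCompact_Icc J |>.isClosed
    have hsub : BoxIntegral.Box.Icc (unitBox n) ⊆ ⋃ J ∈ π.boxes, BoxIntegral.Box.Icc J := by
      have h1 : ((unitBox n : BoxIntegral.Box (Fin n)) : Set (Fin n → ℝ)) ⊆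
          ⋃ J ∈ π.boxes, BoxIntegral.Box.Icc J := fun y hy => by
        obtain ⟨J, hJ, hy⟩ := hpart y hy
        exact mem_biUnion hJ (BoxIntegral.Box.coe_subset_Icc hy)
      have h2 := closure_minimal h1 hclosed
      rw [BoxIntegral.Box.coe_eq_pi, closure_pi_set] at h2
      rw [BoxIntegral.Box.Icc_eq_pi]
      simpa only [closure_Ioc ((unitBox n).lower_ne_upper _)] using h2
    obtain ⟨J, hJm, hx⟩ := mem_iUnion₂.1 (hsub (a := fun i => (unitIso (x i) : ℝ))
      ⟨fun i => (unitIso (x i)).2.1, fun i => (unitIso (x i)).2.2⟩)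
    refine ⟨cell J, Finset.mem_image_of_mem _ hJm, ?_⟩
    have := hmem J hJm _ hx
    simpa only [fromUnit_unitIso] using this
  · rintro c hc
    obtain ⟨J, h, rfl⟩ := Finset.mem_image.1 hc
    intro x hx
    have hxJ : (fun i => (unitIso (x i) : ℝ)) ∈ BoxIntegral.Box.Icc J := by
      constructor
      · intro i
        obtain ⟨h0, h1, h2⟩ := hJ J h i
        exact not_lt.1 fun hh => not_lt.2 (hx.1 i) ((hupp h0 (h1.le.trans h2)).2 hh)
      · intro i
        obtain ⟨h0, h1, h2⟩ := hJ J h i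
        exact not_lt.1 fun hh => not_lt.2 (hx.2 i) ((hlow (h0.trans h1.le) h2).2 hh)
    have := hr _ (hsub J h hxJ)
    simpa only [mem_preimage, fromUnit_unitIso] using this
  · rintro c hc ⟨i, t⟩ hp
    obtain ⟨J, h, rfl⟩ := Finset.mem_image.1 hc
    have hpS : (i, (unitIso t : ℝ)) ∈ S := Finset.mem_image.2 ⟨(i, t), hp, rfl⟩
    obtain ⟨J', hJ', hle'⟩ := (hle.trans (BoxIntegral.Prepartition.splitMany_le_split
      (unitBox n) hpS)) h
    obtain ⟨h0, h1, h2⟩ := hJ J h i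
    -- If the grid value were strictly inside the side, `J` would contain its upper corner, beyond
    -- that value, and also a point exactly on it. Neither half of the split box contains both.
    by_contra hcon
    simp only [not_or, not_le] at hcon
    have hl := (hlow h0 (h1.le.trans h2)).1 hcon.1
    have hu := (hupp (h0.trans h1.le) h2).1 hcon.2
    have hup : J.upper ∈ (J : Set (Fin n → ℝ)) := J.upper_mem
    have hmid : Function.update J.upper i (unitIso t : ℝ) ∈ (J : Set (Fin n → ℝ)) := by
      intro l
      rcases eq_or_ne l i with rfl | hl'
      · rw [Function.update_self]; exact ⟨hl, hu.le⟩
      · rw [Function.update_of_ne hl']; exact J.upper_mem l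
    have hss : (J : Set (Fin n → ℝ)) ⊆ J' := hle'
    rcases BoxIntegral.Prepartition.mem_split_iff'.1 hJ' with e | e
    · have := hss hup
      rw [e] at this
      exact absurd this.2 (not_le.2 hu)
    · have := hss hmid
      rw [e] at this
      simpa using this.2

/-- Cousin's lemma gives a partition fine for both gauges; its single Riemann sum is close to both
values. -/
lemma HasHKIntegral.unique {n : ℕ} {f : (Fin n → ℝ) → ℂ} {I I' : ℂ} (h : HasHKIntegral f I)
    (h' : HasHKIntegral f I') : I = I' := by
  refine eq_of_norm_sub_le_zero (le_of_forall_pos_lt_add fun ε hε => ?_)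
  obtain ⟨γ, hγ, H⟩ := h (ε / 2) (half_pos hε)
  obtain ⟨γ', hγ', H'⟩ := h' (ε / 2) (half_pos hε)
  obtain ⟨P, hP, -⟩ := exists_isFine (IsGauge.inter hγ hγ') ∅
  have h1 := H P (hP.mono fun _ => inter_subset_left)
  have h2 := H' P (hP.mono fun _ => inter_subset_right)
  calc ‖I - I'‖ = ‖(P.riemannSum f - I') - (P.riemannSum f - I)‖ := by congr 1; ring
    _ ≤ _ := norm_sub_le _ _
    _ < 0 + ε := by linarith

lemma HasHKIntegral.hkIntegral_eq {n : ℕ} {f : (Fin n → ℝ) → ℂ} {I : ℂ}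
    (h : HasHKIntegral f I) : hkIntegral f = I := by
  have hf : HKIntegrable f := ⟨I, h⟩
  rw [hkIntegral, dif_pos hf]
  exact hf.choose_spec.unique h

/-! ### A Saks–Henstock lemma for cells that need not contain their tags -/

/-- The contribution of a cell to the Riemann sums of `f`. -/
noncomputable def Cell.term {n : ℕ} (f : (Fin n → ℝ) → ℂ) (c : Cell n) : ℂ :=
  (c.volume : ℂ) * extendZero f c.tag

/-- The cell `q` is contained in the cell `k`. -/
def Cell.Within {n : ℕ} (q k : Cell n) : Prop :=
  ∀ i, k.lower i ≤ q.lower i ∧ q.upper i ≤ k.upper i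

/-- The open side of `q` in each direction avoids the endpoints of `k`. -/
def Cell.AvoidsEnds {n : ℕ} (q k : Cell n) : Prop :=
  ∀ i, (k.lower i ≤ q.lower i ∨ q.upper i ≤ k.lower i) ∧
    (k.upper i ≤ q.lower i ∨ q.upper i ≤ k.upper i)

/-- The interior of a cell. -/
def Cell.inside {n : ℕ} (c : Cell n) : Set (Fin n → EReal) :=
  univ.pi fun i => Ioo (c.lower i) (c.upper i)

lemma Cell.Within.inside_subset {n : ℕ} {q k : Cell n} (h : q.Within k) :
    q.inside ⊆ k.inside := fun _ hx i _ =>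
  ⟨(h i).1.trans_lt (hx i trivial).1, (hx i trivial).2.trans_le (h i).2⟩

lemma Cell.inside_nonempty {n : ℕ} {c : Cell n} (h : ∀ i, c.lower i < c.upper i) :
    c.inside.Nonempty := by
  choose x hx using fun i => exists_between (h i)
  exact ⟨x, fun i _ => hx i⟩

lemma Cell.AvoidsEnds.within {n : ℕ} {q k : Cell n} (h : q.AvoidsEnds k) {x : Fin n → EReal}
    (hx : x ∈ q.inside) (hk : x ∈ Icc k.lower k.upper) : q.Within k := fun i =>
  ⟨(h i).1.resolve_right fun h' => not_lt.2 (hk.1 i) ((hx i trivial).2.trans_le h'),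
    (h i).2.resolve_left fun h' => not_lt.2 (hk.2 i) (h'.trans_lt (hx i trivial).1)⟩

lemma TaggedPartition.eq_of_mem_inside {n : ℕ} (P : TaggedPartition n) {c c' : Cell n}
    (hc : c ∈ P.cells) (hc' : c' ∈ P.cells) {x : Fin n → EReal} (hx : x ∈ c.inside)
    (hx' : x ∈ c'.inside) : c = c' := by
  by_contra hne
  exact disjoint_left.1 (P.nonoverlapping c hc c' hc' hne) hx hx'

-- The cells of `R`, completed by the cells of `Q` that lie within none of them, form another fine
-- partition. Comparing its Riemann sum with that of `Q` cancels the completing cells, and only the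
-- difference over `R` remains.
open Classical in
lemma norm_sum_term_sub_le {n : ℕ} {f : (Fin n → ℝ) → ℂ} {ε : ℝ}
    {γ : (Fin n → EReal) → Set (Fin n → EReal)}
    (hC : ∀ P P' : TaggedPartition n, P.IsFine γ → P'.IsFine γ →
      ‖P.riemannSum f - P'.riemannSum f‖ ≤ ε)
    {Q : TaggedPartition n} (hQ : Q.IsFine γ) {R : Finset (Cell n)}
    (hlt : ∀ k ∈ R, ∀ i, k.lower i < k.upper i)
    (htag : ∀ k ∈ R, k.tag ∈ Icc k.lower k.upper)
    (hfine : ∀ k ∈ R, Icc k.lower k.upper ⊆ γ k.tag)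
    (hends : ∀ k ∈ R, ∀ q ∈ Q.cells, q.AvoidsEnds k)
    (hdisj : ∀ k ∈ R, ∀ k' ∈ R, k ≠ k' → Disjoint k.inside k'.inside) :
    ‖∑ k ∈ R, k.term f - ∑ k ∈ R, ∑ q ∈ Q.cells with q.Within k, q.term f‖ ≤ ε := by
  set S := Q.cells.filter fun q => ∀ k ∈ R, ¬ q.Within k with hS
  have hRS : Disjoint R S := Finset.disjoint_left.2 fun k hk hk' =>
    (Finset.mem_filter.1 hk').2 k hk fun i => ⟨le_rfl, le_rfl⟩
  have hcross : ∀ k ∈ R, ∀ q ∈ S, Disjoint k.inside q.inside := fun k hk q hq =>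
    disjoint_left.2 fun x hx hx' => (Finset.mem_filter.1 hq).2 k hk
      ((hends k hk q (Finset.mem_filter.1 hq).1).within hx'
        ⟨fun i => (hx i trivial).1.le, fun i => (hx i trivial).2.le⟩)
  let M : TaggedPartition n :=
    { cells := R ∪ S
      lower_lt_upper := fun c hc => (Finset.mem_union.1 hc).elim (hlt c) fun h =>
        Q.lower_lt_upper c (Finset.mem_filter.1 h).1
      tag_mem := fun c hc => (Finset.mem_union.1 hc).elim (htag c) fun h =>
        Q.tag_mem c (Finset.mem_filter.1 h).1
      nonoverlapping := fun c hc c' hc' hne => by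
        rcases Finset.mem_union.1 hc with h | h <;> rcases Finset.mem_union.1 hc' with h' | h'
        · exact hdisj c h c' h' hne
        · exact hcross c h c' h'
        · exact (hcross c' h' c h).symm
        · exact Q.nonoverlapping c (Finset.mem_filter.1 h).1 c' (Finset.mem_filter.1 h').1 hne
      covers := fun x => by
        obtain ⟨q, hq, hx⟩ := Q.covers x
        by_cases h : ∀ k ∈ R, ¬ q.Within k
        · exact ⟨q, Finset.mem_union_right _ (Finset.mem_filter.2 ⟨hq, h⟩), hx⟩
        · push Not at h
          obtain ⟨k, hk, hqk⟩ := h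
          exact ⟨k, Finset.mem_union_left _ hk, fun i => (hqk i).1.trans (hx.1 i),
            fun i => (hx.2 i).trans (hqk i).2⟩ }
  have hM : M.IsFine γ := fun c hc => (Finset.mem_union.1 hc).elim (hfine c) fun h =>
    hQ c (Finset.mem_filter.1 h).1
  have h1 : M.riemannSum f = ∑ k ∈ R, k.term f + ∑ q ∈ S, q.term f :=
    Finset.sum_union hRS
  have h2 : Q.riemannSum f = ∑ q ∈ S, q.term f +
      ∑ k ∈ R, ∑ q ∈ Q.cells with q.Within k, q.term f := by
    have e : Q.cells.filter (fun q => ¬ ∀ k ∈ R, ¬ q.Within k) =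
        R.biUnion fun k => Q.cells.filter fun q => q.Within k := by
      ext q
      simp only [not_forall, not_not, Finset.mem_filter, Finset.mem_biUnion]
      constructor
      · rintro ⟨hq, k, hk, h⟩; exact ⟨k, hk, hq, h⟩
      · rintro ⟨k, hk, hq, h⟩; exact ⟨hq, k, hk, h⟩
    rw [TaggedPartition.riemannSum, ← Finset.sum_filter_add_sum_filter_not Q.cells
      (fun q => ∀ k ∈ R, ¬ q.Within k), e, Finset.sum_biUnion]
    · rfl
    · intro k hk k' hk' hne
      refine Finset.disjoint_left.2 fun q hq hq' => ?_
      obtain ⟨hqQ, hw⟩ := Finset.mem_filter.1 hq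
      obtain ⟨x, hx⟩ := Cell.inside_nonempty (Q.lower_lt_upper q hqQ)
      exact disjoint_left.1 (hdisj k hk k' hk' hne) (hw.inside_subset hx)
        ((Finset.mem_filter.1 hq').2.inside_subset hx)
  have h3 := hC M Q hM hQ
  rw [h1, h2] at h3
  convert h3 using 2
  ring

/-! ### Inclusion–exclusion for the part of a cell below a point -/

lemma prod_sub_eq_sum {ι R : Type*} [Fintype ι] [DecidableEq ι] [CommRing R] (A B : ι → R) :
    ∏ i, (A i - B i) = ∑ s : Finset ι, (-1) ^ s.card * ∏ i, if i ∈ s then B i else A i := by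
  have h := Finset.prod_add (fun i => -B i) A Finset.univ
  simp only [Finset.powerset_univ] at h
  calc ∏ i, (A i - B i) = ∏ i, (-B i + A i) := Finset.prod_congr rfl fun i _ => by ring
    _ = _ := h
    _ = _ := Finset.sum_congr rfl fun s _ => by
      rw [Finset.prod_ite, Finset.prod_neg, mul_assoc]
      congr 3
      · ext i; simp
      · ext i; simp

/-- The part of the cell `c` below `a` is a signed sum, over `s`, of cells that contain the tag of
`c`: in direction `i` these are `(i ∉ s)` the side of `c`, cut at `a i` if `a i` is above the tag,
and `(i ∈ s)` the part of the side above `a i` if `a i` is below the tag. -/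
noncomputable def Cell.cut {n : ℕ} (a : Fin n → EReal) (s : Finset (Fin n)) (c : Cell n) :
    Cell n where
  tag := c.tag
  lower i := if i ∈ s then (if a i < c.tag i then max (c.lower i) (a i) else c.upper i)
    else c.lower i
  upper i := if i ∈ s then c.upper i
    else (if a i < c.tag i then c.upper i else min (c.upper i) (a i))

/-- The volume of the part of a cell that lies below `a`. -/
noncomputable def Cell.volumeBelow {n : ℕ} (a : Fin n → EReal) (c : Cell n) : ℝ :=
  ∏ i, ((min (c.upper i) (a i)).toReal - (min (c.lower i) (a i)).toReal)

/-- In each direction the length below `a i` is a difference of two lengths: the whole side minus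
its part above `a i` when `a i` is below the tag, and otherwise the cut side minus the degenerate
interval at the upper end. Multiplying out gives the sum over `s`. -/
lemma Cell.volumeBelow_eq_sum {n : ℕ} {c : Cell n} (hc : c.tag ∈ Icc c.lower c.upper)
    (a : Fin n → EReal) :
    c.volumeBelow a = ∑ s : Finset (Fin n), (-1) ^ s.card * (c.cut a s).volume := by
  have h := prod_sub_eq_sum
    (fun i => (if a i < c.tag i then c.upper i else min (c.upper i) (a i)).toReal -
      (c.lower i).toReal)
    (fun i => (c.upper i).toReal -
      (if a i < c.tag i then max (c.lower i) (a i) else c.upper i).toReal)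
  have e : c.volumeBelow a = ∏ i,
      (((if a i < c.tag i then c.upper i else min (c.upper i) (a i)).toReal -
      (c.lower i).toReal) - ((c.upper i).toReal -
      (if a i < c.tag i then max (c.lower i) (a i) else c.upper i).toReal)) := by
    refine Finset.prod_congr rfl fun i _ => ?_
    have hl := hc.1 i
    have hu := hc.2 i
    split_ifs with hi
    · rw [min_eq_right (hi.le.trans hu)]
      rcases le_total (c.lower i) (a i) with h | h
      · rw [min_eq_left h, max_eq_right h]; ring
      · rw [min_eq_right h, max_eq_left h]; ring
    · rw [min_eq_left (hl.trans (not_lt.1 hi))]; ring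
  rw [e, h]
  refine Finset.sum_congr rfl fun s _ => ?_
  congr 1
  refine Finset.prod_congr rfl fun i _ => ?_
  simp only [Cell.cut]
  split_ifs <;> rfl

lemma Cell.cut_within {n : ℕ} (c : Cell n) (hc : c.tag ∈ Icc c.lower c.upper)
    (a : Fin n → EReal) (s : Finset (Fin n)) : (c.cut a s).Within c := fun i => by
  have h := (hc.1 i).trans (hc.2 i)
  simp only [Cell.cut]
  constructor <;> split_ifs <;> simp [h]

lemma Cell.cut_lower_le_upper {n : ℕ} (c : Cell n) (hc : c.tag ∈ Icc c.lower c.upper)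
    (a : Fin n → EReal) (s : Finset (Fin n)) (i : Fin n) :
    (c.cut a s).lower i ≤ (c.cut a s).upper i := by
  have hl := hc.1 i
  have hu := hc.2 i
  simp only [Cell.cut]
  split_ifs with h1 h2 h2
  · exact max_le (hl.trans hu) (h2.le.trans hu)
  · exact le_rfl
  · exact hl.trans hu
  · exact le_min (hl.trans hu) (hl.trans (not_lt.1 h2))

lemma Cell.tag_mem_cut {n : ℕ} (c : Cell n) (hc : c.tag ∈ Icc c.lower c.upper)
    (a : Fin n → EReal) (s : Finset (Fin n))
    (hlt : ∀ i, (c.cut a s).lower i < (c.cut a s).upper i) :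
    (c.cut a s).tag ∈ Icc (c.cut a s).lower (c.cut a s).upper := by
  refine ⟨fun i => ?_, fun i => ?_⟩ <;> have hl := hc.1 i <;> have hu := hc.2 i <;>
    have h := hlt i <;> simp only [Cell.cut] at h ⊢ <;> split_ifs at h ⊢ with h1 h2 h2
  · exact max_le hl h2.le
  · exact absurd h (lt_irrefl _)
  · exact hl
  · exact hl
  · exact hu
  · exact hu
  · exact hu
  · exact le_min hu (not_lt.1 h2)

-- The expansion used for volumes is applied to indicators. In each direction the indicator of lying
-- in the first interval minus that of lying in the second is the indicator of lying below `a i`,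
-- since `a i` does not cut `q`.
open Classical in
lemma Cell.sum_within_cut {n : ℕ} {q c : Cell n}
    (hq : ∀ i, q.lower i < q.upper i) (hqc : q.Within c) {a : Fin n → EReal}
    (ha : ∀ i, a i ≤ q.lower i ∨ q.upper i ≤ a i) :
    (∑ s : Finset (Fin n), (-1) ^ s.card * if q.Within (c.cut a s) then (1 : ℂ) else 0) =
      if ∀ i, q.upper i ≤ a i then 1 else 0 := by
  have h := prod_sub_eq_sum
    (fun i => if q.upper i ≤ (if a i < c.tag i then c.upper i else min (c.upper i) (a i))
      then (1 : ℂ) else 0)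
    (fun i => if (if a i < c.tag i then max (c.lower i) (a i) else c.upper i) ≤ q.lower i
      then (1 : ℂ) else 0)
  have e : ∀ s : Finset (Fin n), (if q.Within (c.cut a s) then (1 : ℂ) else 0) = ∏ i,
      if i ∈ s then
        (if (if a i < c.tag i then max (c.lower i) (a i) else c.upper i) ≤ q.lower i
          then (1 : ℂ) else 0)
      else (if q.upper i ≤ (if a i < c.tag i then c.upper i else min (c.upper i) (a i))
          then (1 : ℂ) else 0) := fun s => by
    have : ∀ i, (if i ∈ s then
        (if (if a i < c.tag i then max (c.lower i) (a i) else c.upper i) ≤ q.lower i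
          then (1 : ℂ) else 0)
      else (if q.upper i ≤ (if a i < c.tag i then c.upper i else min (c.upper i) (a i))
          then (1 : ℂ) else 0)) =
        if ((c.cut a s).lower i ≤ q.lower i ∧ q.upper i ≤ (c.cut a s).upper i)
          then (1 : ℂ) else 0 := fun i => by
      simp only [Cell.cut]
      by_cases hi : i ∈ s
      · simp only [if_pos hi, (hqc i).2, and_true]
      · simp only [if_neg hi, (hqc i).1, true_and]
    rw [Finset.prod_congr rfl fun i _ => this i, Finset.prod_ite_zero]
    simp only [Cell.Within, Finset.mem_univ, true_imp_iff, Finset.prod_const_one]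
    congr
  rw [Finset.sum_congr rfl fun s _ => by rw [e s], ← h]
  have e2 : ∀ i, ((if q.upper i ≤ (if a i < c.tag i then c.upper i else min (c.upper i) (a i))
      then (1 : ℂ) else 0) -
      if (if a i < c.tag i then max (c.lower i) (a i) else c.upper i) ≤ q.lower i
      then (1 : ℂ) else 0) = if q.upper i ≤ a i then 1 else 0 := fun i => by
    by_cases hi : a i < c.tag i
    · simp only [if_pos hi, (hqc i).2, if_true, max_le_iff, (hqc i).1, true_and]
      rcases ha i with h' | h'
      · rw [if_pos h', if_neg (not_le.2 (h'.trans_lt (hq i)))]; ring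
      · rw [if_neg (not_le.2 ((hq i).trans_le h')), if_pos h']; ring
    · simp only [if_neg hi, le_min_iff, (hqc i).2, true_and]
      rw [if_neg (not_le.2 ((hq i).trans_le (hqc i).2)), sub_zero]
  rw [Finset.prod_congr rfl fun i _ => e2 i, Finset.prod_ite_zero]
  simp

/-! ### Riemann sums truncated at a point -/

/-- The Riemann sum over the parts of the cells that lie below `a`. -/
noncomputable def TaggedPartition.sumBelow {n : ℕ} (P : TaggedPartition n)
    (f : (Fin n → ℝ) → ℂ) (a : Fin n → EReal) : ℂ :=
  ∑ c ∈ P.cells, (c.volumeBelow a : ℂ) * extendZero f c.tag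

-- For each fixed `s` the nondegenerate cuts form a fine nonoverlapping family whose cells contain
-- their tags, so the Saks–Henstock estimate costs `ε`. Summing over the `2 ^ n` sets `s` with signs
-- turns the cuts into the parts below `a`, and the cells of `Q` within them into the cells of `Q`
-- below `a`.
open Classical in
lemma TaggedPartition.norm_sumBelow_sub_le {n : ℕ} {f : (Fin n → ℝ) → ℂ} {ε : ℝ}
    {γ : (Fin n → EReal) → Set (Fin n → EReal)}
    (hC : ∀ P P' : TaggedPartition n, P.IsFine γ → P'.IsFine γ →
      ‖P.riemannSum f - P'.riemannSum f‖ ≤ ε)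
    {P Q : TaggedPartition n} (hP : P.IsFine γ) (hQ : Q.IsFine γ)
    (hPQ : ∀ c ∈ P.cells, ∀ q ∈ Q.cells, q.AvoidsEnds c) {a : Fin n → EReal}
    (ha : ∀ q ∈ Q.cells, ∀ i, a i ≤ q.lower i ∨ q.upper i ≤ a i) :
    ‖P.sumBelow f a - ∑ q ∈ Q.cells with ∀ i, q.upper i ≤ a i, q.term f‖ ≤ 2 ^ n * ε := by
  have key : ∀ s : Finset (Fin n), ‖∑ c ∈ P.cells, (c.cut a s).term f -
      ∑ q ∈ Q.cells, ∑ c ∈ P.cells, (if q.Within (c.cut a s) then (1 : ℂ) else 0) * q.term f‖ ≤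
        ε := by
    intro s
    -- Degenerate cuts can be dropped: they have volume zero and no cell of `Q` lies within them.
    set P' := P.cells.filter fun c => ∀ i, (c.cut a s).lower i < (c.cut a s).upper i with hP'
    have hin : ∀ c ∈ P', (c.cut a s).inside ⊆ c.inside := fun c hc =>
      (c.cut_within (P.tag_mem c (Finset.mem_filter.1 hc).1) a s).inside_subset
    have hinj : Set.InjOn (Cell.cut a s) P' := by
      intro c hc c' hc' he
      obtain ⟨x, hx⟩ := Cell.inside_nonempty (Finset.mem_filter.1 hc).2
      exact P.eq_of_mem_inside (Finset.mem_filter.1 hc).1 (Finset.mem_filter.1 hc').1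
        (hin c hc hx) (hin c' hc' (by rw [← he]; exact hx))
    have h := norm_sum_term_sub_le hC hQ (R := P'.image (Cell.cut a s)) ?_ ?_ ?_ ?_ ?_
    · rw [Finset.sum_image hinj, Finset.sum_image hinj] at h
      convert h using 2
      congr 1
      · refine (Finset.sum_filter_of_ne fun c hc hne => ?_).symm
        intro i
        refine lt_of_le_of_ne (c.cut_lower_le_upper (P.tag_mem c hc) a s i) fun heq => hne ?_
        rw [Cell.term, Cell.volume, Finset.prod_eq_zero (Finset.mem_univ i)
          (by rw [heq, sub_self])]
        simp
      · rw [Finset.sum_comm]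
        simp only [ite_mul, one_mul, zero_mul, ← Finset.sum_filter]
        refine (Finset.sum_filter_of_ne fun c hc hne i => ?_).symm
        obtain ⟨q, hq, -⟩ := Finset.exists_ne_zero_of_sum_ne_zero hne
        obtain ⟨hq, hw⟩ := Finset.mem_filter.1 hq
        exact ((hw i).1.trans_lt (Q.lower_lt_upper q hq i)).trans_le (hw i).2
    · intro k hk
      obtain ⟨c, hc, rfl⟩ := Finset.mem_image.1 hk
      exact (Finset.mem_filter.1 hc).2
    · intro k hk
      obtain ⟨c, hc, rfl⟩ := Finset.mem_image.1 hk
      exact c.tag_mem_cut (P.tag_mem c (Finset.mem_filter.1 hc).1) a s (Finset.mem_filter.1 hc).2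
    · intro k hk
      obtain ⟨c, hc, rfl⟩ := Finset.mem_image.1 hk
      have hcP := (Finset.mem_filter.1 hc).1
      have hw := c.cut_within (P.tag_mem c hcP) a s
      exact (Icc_subset_Icc (fun i => (hw i).1) fun i => (hw i).2).trans (hP c hcP)
    · intro k hk q hq i
      obtain ⟨c, hc, rfl⟩ := Finset.mem_image.1 hk
      have hcP := (Finset.mem_filter.1 hc).1
      have h1 := hPQ c hcP q hq i
      have h2 := ha q hq i
      simp only [Cell.cut]
      constructor
      · split_ifs
        · rcases le_total (c.lower i) (a i) with h | h
          · rwa [max_eq_right h]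
          · rw [max_eq_left h]; exact h1.1
        · exact h1.2
        · exact h1.1
      · split_ifs
        · exact h1.2
        · exact h1.2
        · rcases le_total (c.upper i) (a i) with h | h
          · rw [min_eq_left h]; exact h1.2
          · rwa [min_eq_right h]
    · intro k hk k' hk' hne
      obtain ⟨c, hc, rfl⟩ := Finset.mem_image.1 hk
      obtain ⟨c', hc', rfl⟩ := Finset.mem_image.1 hk'
      exact (P.nonoverlapping c (Finset.mem_filter.1 hc).1 c' (Finset.mem_filter.1 hc').1
        (fun e => hne (by rw [e]))).mono (hin c hc) (hin c' hc')
  have e1 : P.sumBelow f a = ∑ s : Finset (Fin n), (-1) ^ s.card *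
      ∑ c ∈ P.cells, (c.cut a s).term f := by
    simp only [Finset.mul_sum]
    rw [Finset.sum_comm]
    refine Finset.sum_congr rfl fun c hc => ?_
    rw [Cell.volumeBelow_eq_sum (P.tag_mem c hc)]
    push_cast
    rw [Finset.sum_mul]
    refine Finset.sum_congr rfl fun s _ => ?_
    rw [Cell.term, mul_assoc]
    rfl
  have e2 : (∑ q ∈ Q.cells with ∀ i, q.upper i ≤ a i, q.term f) =
      ∑ s : Finset (Fin n), (-1) ^ s.card * ∑ q ∈ Q.cells, ∑ c ∈ P.cells,
        (if q.Within (c.cut a s) then (1 : ℂ) else 0) * q.term f := by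
    simp only [Finset.mul_sum]
    rw [Finset.sum_comm, Finset.sum_filter]
    refine Finset.sum_congr rfl fun q hq => ?_
    obtain ⟨x, hx⟩ := Cell.inside_nonempty (Q.lower_lt_upper q hq)
    obtain ⟨c, hc, hxc⟩ := P.covers x
    have hw := (hPQ c hc q hq).within hx hxc
    have := Cell.sum_within_cut (Q.lower_lt_upper q hq) hw (ha q hq)
    -- Only the cell of `P` that contains `q` can contribute, because distinct cells of `P` have
    -- disjoint interiors.
    have h3 : ∀ s : Finset (Fin n), ∑ c' ∈ P.cells, (-1 : ℂ) ^ s.card *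
        ((if q.Within (c'.cut a s) then (1 : ℂ) else 0) * q.term f) =
        ((-1 : ℂ) ^ s.card * if q.Within (c.cut a s) then (1 : ℂ) else 0) * q.term f := by
      intro s
      rw [Finset.sum_eq_single_of_mem c hc, mul_assoc]
      intro c' hc' hne
      rw [if_neg, zero_mul, mul_zero]
      intro hw'
      exact hne (P.eq_of_mem_inside hc' hc
        ((c'.cut_within (P.tag_mem c' hc') a s).inside_subset (hw'.inside_subset hx))
        (hw.inside_subset hx))
    rw [Finset.sum_congr rfl fun s _ => h3 s, ← Finset.sum_mul, this]
    simp
  rw [e1, e2, ← Finset.sum_sub_distrib]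
  refine (norm_sum_le _ _).trans ?_
  calc ∑ s : Finset (Fin n), ‖_‖ ≤ ∑ _s : Finset (Fin n), ε :=
        Finset.sum_le_sum fun s _ => by
          rw [← mul_sub, norm_mul]
          simpa using key s
    _ = 2 ^ n * ε := by simp

/-- Both sums are compared with a fine partition `Q` that avoids the endpoints of `P` and `P'` and
the coordinates of `a`. Only `Q` depends on `a`; the gauge does not, which is the uniformity needed
later. -/
lemma TaggedPartition.norm_sumBelow_sub_sumBelow_le {n : ℕ} {f : (Fin n → ℝ) → ℂ} {ε : ℝ}
    {γ : (Fin n → EReal) → Set (Fin n → EReal)} (hγ : IsGauge γ)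
    (hC : ∀ P P' : TaggedPartition n, P.IsFine γ → P'.IsFine γ →
      ‖P.riemannSum f - P'.riemannSum f‖ ≤ ε)
    {P P' : TaggedPartition n} (hP : P.IsFine γ) (hP' : P'.IsFine γ) (a : Fin n → EReal) :
    ‖P.sumBelow f a - P'.sumBelow f a‖ ≤ 2 * (2 ^ n * ε) := by
  classical
  let ends : Finset (Cell n) → Finset (Fin n × EReal) := fun C =>
    C.biUnion fun c => Finset.univ.image (fun i => (i, c.lower i)) ∪
      Finset.univ.image fun i => (i, c.upper i)
  obtain ⟨Q, hQ, hG⟩ := exists_isFine hγ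
    (ends P.cells ∪ ends P'.cells ∪ Finset.univ.image fun i => (i, a i))
  have hav : ∀ C : Finset (Cell n), (∀ q ∈ Q.cells, q.AvoidsGrid (ends C)) →
      ∀ c ∈ C, ∀ q ∈ Q.cells, q.AvoidsEnds c := fun C h c hc q hq i =>
    ⟨h q hq (i, c.lower i) (Finset.mem_biUnion.2 ⟨c, hc, by simp⟩),
      (h q hq (i, c.upper i) (Finset.mem_biUnion.2 ⟨c, hc, by simp⟩))⟩
  have ha : ∀ q ∈ Q.cells, ∀ i, a i ≤ q.lower i ∨ q.upper i ≤ a i := fun q hq i =>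
    hG q hq (i, a i) (by simp)
  have h1 := norm_sumBelow_sub_le hC hP hQ (hav _ fun q hq p hp => hG q hq p (by simp [hp])) ha
  have h2 := norm_sumBelow_sub_le hC hP' hQ (hav _ fun q hq p hp => hG q hq p (by simp [hp])) ha
  rw [norm_sub_rev] at h2
  have := norm_sub_le_norm_sub_add_norm_sub (P.sumBelow f a)
    (∑ q ∈ Q.cells with ∀ i, q.upper i ≤ a i, q.term f) (P'.sumBelow f a)
  linarith

/-! ### Cells that meet a hyperplane -/

/-- The open boxes are pairwise disjoint and lie in one bounded box, so additivity of Lebesgue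
measure applies. -/
lemma sum_volume_le {n : ℕ} {C : Finset (Cell n)} {α β : Fin n → ℝ} (hαβ : ∀ i, α i ≤ β i)
    (hlt : ∀ c ∈ C, ∀ i, c.lower i < c.upper i)
    (hl : ∀ c ∈ C, ∀ i, (α i : EReal) ≤ c.lower i) (hu : ∀ c ∈ C, ∀ i, c.upper i ≤ (β i : EReal))
    (hdisj : ∀ c ∈ C, ∀ c' ∈ C, c ≠ c' → Disjoint c.inside c'.inside) :
    ∑ c ∈ C, c.volume ≤ ∏ i, (β i - α i) := by
  let B : Cell n → Set (Fin n → ℝ) := fun c =>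
    univ.pi fun i => Ioo (c.lower i).toReal (c.upper i).toReal
  have hfl : ∀ c ∈ C, ∀ i, ((c.lower i).toReal : EReal) = c.lower i := fun c hc i =>
    EReal.coe_toReal ((hlt c hc i).trans_le le_top).ne ((EReal.bot_lt_coe _).trans_le (hl c hc i)).ne'
  have hfu : ∀ c ∈ C, ∀ i, ((c.upper i).toReal : EReal) = c.upper i := fun c hc i =>
    EReal.coe_toReal ((hu c hc i).trans_lt (EReal.coe_lt_top _)).ne (bot_le.trans_lt (hlt c hc i)).ne'
  have hle : ∀ c ∈ C, ∀ i, (c.lower i).toReal ≤ (c.upper i).toReal := fun c hc i => by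
    rw [← EReal.coe_le_coe_iff, hfl c hc, hfu c hc]; exact (hlt c hc i).le
  have hvol : ∀ c ∈ C, c.volume = (volume : Measure (Fin n → ℝ)).real (B c) := fun c hc =>
    (Real.volume_pi_Ioo_toReal (hle c hc)).symm
  have hfin : ∀ c ∈ C, (volume : Measure (Fin n → ℝ)) (B c) ≠ ⊤ := fun c _ => by
    rw [Real.volume_pi_Ioo]; exact ENNReal.prod_ne_top fun i _ => ENNReal.ofReal_ne_top
  rw [Finset.sum_congr rfl hvol, ← measureReal_biUnion_finset ?_ ?_ hfin]
  · rw [← Real.volume_pi_Ioo_toReal hαβ]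
    refine measureReal_mono (iUnion₂_subset fun c hc => pi_mono fun i _ =>
      Ioo_subset_Ioo ?_ ?_) ?_
    · rw [← EReal.coe_le_coe_iff, hfl c hc]; exact hl c hc i
    · rw [← EReal.coe_le_coe_iff, hfu c hc]; exact hu c hc i
    · rw [Real.volume_pi_Ioo]; exact ENNReal.prod_ne_top fun i _ => ENNReal.ofReal_ne_top
  · intro c hc c' hc' hne
    have hd : ∀ y, y ∈ c.inside → y ∈ c'.inside → False := fun y hy hy' =>
      disjoint_left.1 (hdisj c hc c' hc' hne) hy hy'
    refine disjoint_left.2 fun x hx hx' => hd (fun i => (x i : EReal)) ?_ ?_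
    · intro i _
      change (x i : EReal) ∈ Ioo (c.lower i) (c.upper i)
      rw [← hfl c hc, ← hfu c hc]
      exact ⟨EReal.coe_lt_coe_iff.2 (hx i trivial).1, EReal.coe_lt_coe_iff.2 (hx i trivial).2⟩
    · intro i _
      change (x i : EReal) ∈ Ioo (c'.lower i) (c'.upper i)
      rw [← hfl c' hc', ← hfu c' hc']
      exact ⟨EReal.coe_lt_coe_iff.2 (hx' i trivial).1, EReal.coe_lt_coe_iff.2 (hx' i trivial).2⟩
  · exact fun c _ => MeasurableSet.univ_pi fun i => measurableSet_Ioo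

lemma tsum_weight : ∑' m, weight m = 1 := by
  refine (tsum_congr fun m => ?_).trans (tsum_geometric_two' 1)
  rw [weight, pow_succ, one_div_pow]
  ring

lemma sum_weight_le (s : Finset ℕ) : ∑ m ∈ s, weight m ≤ 1 :=
  (summable_weight.sum_le_tsum s fun m _ => (weight_pos m).le).trans_eq tsum_weight

/-- All coordinates are finite. -/
def IsFinitePoint {n : ℕ} (x : Fin n → EReal) : Prop := ∀ i, x i ≠ ⊥ ∧ x i ≠ ⊤

lemma extendZero_of_not {n : ℕ} {f : (Fin n → ℝ) → ℂ} {x : Fin n → EReal}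
    (hx : ¬ IsFinitePoint x) : extendZero f x = 0 := if_neg hx

lemma extendZero_of {n : ℕ} {f : (Fin n → ℝ) → ℂ} {x : Fin n → EReal}
    (hx : IsFinitePoint x) : extendZero f x = f fun i => (x i).toReal := if_pos hx

/-- The cell meets the hyperplane `x i = a i`. -/
def Cell.Meets {n : ℕ} (c : Cell n) (a : Fin n → EReal) (i : Fin n) : Prop :=
  c.lower i ≤ a i ∧ a i ≤ c.upper i

/-- Cells with a finite tag have finite endpoints. -/
def TaggedPartition.IsBounded {n : ℕ} (P : TaggedPartition n) : Prop :=
  ∀ c ∈ P.cells, IsFinitePoint c.tag → IsFinitePoint c.lower ∧ IsFinitePoint c.upper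

lemma TaggedPartition.volume_nonneg {n : ℕ} {P : TaggedPartition n} (hP : P.IsBounded) {c : Cell n}
    (hc : c ∈ P.cells) (ht : IsFinitePoint c.tag) : 0 ≤ c.volume := by
  obtain ⟨hl, hu⟩ := hP c hc ht
  refine Finset.prod_nonneg fun i _ => sub_nonneg.2 ?_
  exact EReal.toReal_le_toReal (P.lower_lt_upper c hc i).le (hl i).1 (hu i).2

-- Finite tags are sorted by a level that bounds both the value of `f` and the size of the tag. At
-- level `m` the cells meeting a hyperplane lie in a slab of thickness `4 * δ m` inside a box of
-- edge `2 * m + 2`, wherever the hyperplane is. Choosing `δ m` small enough makes the levels sum to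
-- at most `ε`, uniformly in `a`.
open Classical in
lemma exists_gauge_sum_meets_le {n : ℕ} (f : (Fin n → ℝ) → ℂ) {ε : ℝ} (hε : 0 < ε) :
    ∃ γ : (Fin n → EReal) → Set (Fin n → EReal), IsGauge γ ∧ ∀ P : TaggedPartition n,
      P.IsFine γ → P.IsBounded ∧ ∀ a : Fin n → ℝ,
        ∑ c ∈ P.cells with ∃ i, c.Meets (fun i => (a i : EReal)) i, ‖c.term f‖ ≤ ε := by
  let pt : (Fin n → EReal) → Fin n → ℝ := fun x i => (x i).toReal
  let lev : (Fin n → EReal) → ℕ := fun x => ⌈‖f (pt x)‖ + ‖pt x‖⌉₊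
  -- The factors of `K m` absorb the cross-section of the slab, its thickness factor `4`, the bound
  -- `m` for `f`, and the number of directions, with `n + 1` in place of `n` to avoid dividing by
  -- zero.
  let K : ℕ → ℝ := fun m => (2 * m + 2) ^ n * 4 * (m + 1) * (n + 1)
  have hK : ∀ m, 0 < K m := fun m => by positivity
  let δ : ℕ → ℝ := fun m => min 1 (ε * weight m / K m)
  have hδ : ∀ m, 0 < δ m := fun m =>
    lt_min one_pos (div_pos (mul_pos hε (weight_pos m)) (hK m))
  -- Tags with an infinite coordinate contribute zero, so they need no restriction.
  let γ : (Fin n → EReal) → Set (Fin n → EReal) := fun x => if IsFinitePoint x then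
    univ.pi fun i => Ioo ((pt x i - δ (lev x) : ℝ) : EReal) ((pt x i + δ (lev x) : ℝ) : EReal)
    else univ
  have hγ : IsGauge γ := by
    intro x
    by_cases hx : IsFinitePoint x
    · simp only [γ, if_pos hx]
      refine ⟨isOpen_set_pi finite_univ fun i _ => isOpen_Ioo, fun i _ => ?_⟩
      have : x i = (pt x i : EReal) := (EReal.coe_toReal (hx i).2 (hx i).1).symm
      have h0 := hδ (lev x)
      constructor
      · rw [this]; exact EReal.coe_lt_coe_iff.2 (by linarith)
      · nth_rw 1 [this]; exact EReal.coe_lt_coe_iff.2 (by linarith)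
    · simp [γ, if_neg hx]
  refine ⟨γ, hγ, fun P hP => ?_⟩
  have hin : ∀ c ∈ P.cells, IsFinitePoint c.tag → ∀ i,
      ((pt c.tag i - δ (lev c.tag) : ℝ) : EReal) < c.lower i ∧
        c.upper i < ((pt c.tag i + δ (lev c.tag) : ℝ) : EReal) := fun c hc ht i => by
    have h := hP c hc
    simp only [γ, if_pos ht] at h
    have hlu : c.lower ≤ c.upper := fun i => (P.lower_lt_upper c hc i).le
    exact ⟨(h (left_mem_Icc.2 hlu) i trivial).1, (h (right_mem_Icc.2 hlu) i trivial).2⟩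
  have hbdd : P.IsBounded := fun c hc ht => by
    refine ⟨fun i => ⟨?_, ?_⟩, fun i => ⟨?_, ?_⟩⟩ <;> have h := hin c hc ht i <;>
      have hlt := P.lower_lt_upper c hc i
    · exact (bot_le.trans_lt h.1).ne'
    · exact (hlt.trans_le le_top).ne
    · exact (bot_le.trans_lt hlt).ne'
    · exact (h.2.trans_le le_top).ne
  refine ⟨hbdd, fun a => ?_⟩
  set A : Fin n → Finset (Cell n) := fun i =>
    P.cells.filter fun c => IsFinitePoint c.tag ∧ c.Meets (fun i => (a i : EReal)) i with hA
  have hlevel : ∀ i m, ∑ c ∈ A i with lev c.tag = m, ‖c.term f‖ ≤ ε * weight m / (n + 1) := by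
    intro i m
    set C := (A i).filter fun c => lev c.tag = m with hC
    have hCP : ∀ c ∈ C, c ∈ P.cells ∧ IsFinitePoint c.tag ∧
        c.Meets (fun i => (a i : EReal)) i ∧ lev c.tag = m := fun c hc => by
      simpa [hC, hA, and_assoc] using hc
    have hlev : ∀ c ∈ C, ‖f (pt c.tag)‖ + ‖pt c.tag‖ ≤ m := fun c hc => by
      rw [← (hCP c hc).2.2.2]; exact Nat.le_ceil _
    have h1 : ∑ c ∈ C, ‖c.term f‖ ≤ m * ∑ c ∈ C, c.volume := by
      rw [Finset.mul_sum]
      refine Finset.sum_le_sum fun c hc => ?_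
      obtain ⟨hcP, ht, -, -⟩ := hCP c hc
      have h0 := TaggedPartition.volume_nonneg hbdd hcP ht
      rw [Cell.term, norm_mul, Complex.norm_real, Real.norm_of_nonneg h0, extendZero_of ht,
        mul_comm]
      exact mul_le_mul_of_nonneg_right (by linarith [hlev c hc, norm_nonneg (pt c.tag)]) h0
    have hm0 : (0 : ℝ) ≤ m := Nat.cast_nonneg m
    have hδ1 : δ m ≤ 1 := min_le_left _ _
    have h2 : ∑ c ∈ C, c.volume ≤ ∏ j, ((if j = i then a i + 2 * δ m else (m : ℝ) + 1) -
        if j = i then a i - 2 * δ m else -((m : ℝ) + 1)) := by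
      refine sum_volume_le (fun j => ?_) (fun c hc => P.lower_lt_upper c (hCP c hc).1) ?_ ?_
        fun c hc c' hc' => P.nonoverlapping c (hCP c hc).1 c' (hCP c' hc').1
      · have := hδ m
        split_ifs <;> linarith
      · intro c hc j
        obtain ⟨hcP, ht, hmeet, hl⟩ := hCP c hc
        have h := hin c hcP ht j
        rw [hl] at h
        refine le_trans (EReal.coe_le_coe_iff.2 ?_) h.1.le
        have hj : |pt c.tag j| ≤ ‖pt c.tag‖ := norm_le_pi_norm (pt c.tag) j
        have := hlev c hc
        have := norm_nonneg (f (pt c.tag))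
        split_ifs with hji
        · subst hji
          have := hmeet.2.trans_lt h.2
          have := EReal.coe_lt_coe_iff.1 this
          linarith
        · linarith [neg_abs_le (pt c.tag j)]
      · intro c hc j
        obtain ⟨hcP, ht, hmeet, hl⟩ := hCP c hc
        have h := hin c hcP ht j
        rw [hl] at h
        refine h.2.le.trans (EReal.coe_le_coe_iff.2 ?_)
        have hj : |pt c.tag j| ≤ ‖pt c.tag‖ := norm_le_pi_norm (pt c.tag) j
        have := hlev c hc
        have := norm_nonneg (f (pt c.tag))
        split_ifs with hji
        · subst hji
          have := h.1.trans_le hmeet.1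
          have := EReal.coe_lt_coe_iff.1 this
          linarith
        · linarith [le_abs_self (pt c.tag j)]
    have h3 : ∏ j, ((if j = i then a i + 2 * δ m else (m : ℝ) + 1) -
        if j = i then a i - 2 * δ m else -((m : ℝ) + 1)) ≤ 4 * δ m * (2 * m + 2) ^ n := by
      have h4 : ∀ j, ((if j = i then a i + 2 * δ m else (m : ℝ) + 1) -
          if j = i then a i - 2 * δ m else -((m : ℝ) + 1)) =
          if j = i then 4 * δ m else 2 * m + 2 := fun j => by split_ifs <;> ring
      rw [Finset.prod_congr rfl fun j _ => h4 j,
        ← Finset.mul_prod_erase _ _ (Finset.mem_univ i), if_pos rfl,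
        Finset.prod_congr rfl fun j hj => if_neg (Finset.ne_of_mem_erase hj), Finset.prod_const]
      have := hδ m
      -- The cross-section has exponent `n - 1`, which may be raised to `n` because the base is at
      -- least one.
      refine mul_le_mul_of_nonneg_left (pow_le_pow_right₀ (by linarith) ?_) (by positivity)
      simp
    have h5 : δ m ≤ ε * weight m / K m := min_le_right _ _
    calc ∑ c ∈ C, ‖c.term f‖ ≤ m * (4 * δ m * (2 * m + 2) ^ n) :=
          h1.trans (mul_le_mul_of_nonneg_left (h2.trans h3) hm0)
      _ ≤ (m + 1) * (4 * (ε * weight m / K m) * (2 * m + 2) ^ n) := by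
          have := hδ m
          gcongr
          linarith
      _ = ε * weight m / (n + 1) := by
          simp only [K]
          field_simp
  have hdir : ∀ i, ∑ c ∈ A i, ‖c.term f‖ ≤ ε / (n + 1) := by
    intro i
    rw [← Finset.sum_fiberwise_of_maps_to (t := (A i).image fun c => lev c.tag)
      (fun c hc => Finset.mem_image_of_mem _ hc)]
    calc _ ≤ ∑ m ∈ (A i).image fun c => lev c.tag, ε * weight m / (n + 1) :=
          Finset.sum_le_sum fun m _ => hlevel i m
      _ = ε / (n + 1) * ∑ m ∈ (A i).image fun c => lev c.tag, weight m := by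
          rw [Finset.mul_sum]; exact Finset.sum_congr rfl fun m _ => by ring
      _ ≤ ε / (n + 1) := mul_le_of_le_one_right (by positivity) (sum_weight_le _)
  calc ∑ c ∈ P.cells with ∃ i, c.Meets (fun i => (a i : EReal)) i, ‖c.term f‖
      ≤ ∑ c ∈ P.cells, ∑ i, if IsFinitePoint c.tag ∧ c.Meets (fun i => (a i : EReal)) i
          then ‖c.term f‖ else 0 := by
        rw [Finset.sum_filter]
        refine Finset.sum_le_sum fun c _ => ?_
        have h0 : ∀ i ∈ Finset.univ, (0 : ℝ) ≤
            if IsFinitePoint c.tag ∧ c.Meets (fun i => (a i : EReal)) i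
              then ‖c.term f‖ else 0 := fun i _ => by split_ifs <;> positivity
        split_ifs with h
        · obtain ⟨i, hi⟩ := h
          by_cases ht : IsFinitePoint c.tag
          · refine le_trans ?_ (Finset.single_le_sum h0 (Finset.mem_univ i))
            rw [if_pos ⟨ht, hi⟩]
          · rw [Cell.term, extendZero_of_not ht, mul_zero, norm_zero]
            simp
        · exact Finset.sum_nonneg h0
    _ = ∑ i, ∑ c ∈ A i, ‖c.term f‖ := by
        rw [Finset.sum_comm]
        exact Finset.sum_congr rfl fun i _ => (Finset.sum_filter _ _).symm
    _ ≤ ∑ _i : Fin n, ε / (n + 1) := Finset.sum_le_sum fun i _ => hdir i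
    _ ≤ ε := by
        rw [Finset.sum_const, Finset.card_univ, Fintype.card_fin, nsmul_eq_mul, ← mul_div_assoc,
          div_le_iff₀ (by positivity)]
        nlinarith

/-! ### The primitive of an integrable function, uniformly approximated -/

/-- A Cauchy criterion: `Φ` is the limit along one sequence of partitions fine for the tolerances `1
/ (k + 1)`, and passing to the limit in the pairwise estimate gives the bound for every fine
partition. -/
lemma exists_uniform_limit {n : ℕ} {A : Type*} {S : TaggedPartition n → A → ℂ}
    (hS : ∀ ε : ℝ, 0 < ε → ∃ γ : (Fin n → EReal) → Set (Fin n → EReal), IsGauge γ ∧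
      ∀ P P' : TaggedPartition n, P.IsFine γ → P'.IsFine γ → ∀ a, ‖S P a - S P' a‖ ≤ ε) :
    ∃ Φ : A → ℂ, ∀ ε : ℝ, 0 < ε → ∃ γ : (Fin n → EReal) → Set (Fin n → EReal), IsGauge γ ∧
      ∀ P : TaggedPartition n, P.IsFine γ → ∀ a, ‖S P a - Φ a‖ ≤ ε := by
  choose! γ hγ hSγ using hS
  have hpos : ∀ k : ℕ, (0 : ℝ) < 1 / (k + 1) := fun k => Nat.one_div_pos_of_nat
  choose P hP using fun k : ℕ => exists_isFine (hγ _ (hpos k)) ∅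
  -- The gauges for different tolerances need not be nested, so the two partitions are compared
  -- through a third, fine for both gauges.
  have hpair : ∀ {ε ε' : ℝ} (_ : 0 < ε) (_ : 0 < ε') {Q Q' : TaggedPartition n},
      Q.IsFine (γ ε) → Q'.IsFine (γ ε') → ∀ a, ‖S Q a - S Q' a‖ ≤ ε + ε' := by
    intro ε ε' hε hε' Q Q' hQ hQ' a
    obtain ⟨R, hR, -⟩ := exists_isFine ((hγ ε hε).inter (hγ ε' hε')) ∅
    exact (norm_sub_le_norm_sub_add_norm_sub _ (S R a) _).trans (add_le_add
      (hSγ ε hε Q R hQ (hR.mono fun _ => inter_subset_left) a)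
      (hSγ ε' hε' R Q' (hR.mono fun _ => inter_subset_right) hQ' a))
  have hlim : ∀ a, ∃ z, Tendsto (fun k => S (P k) a) atTop (𝓝 z) := fun a => by
    refine cauchySeq_tendsto_of_complete (cauchySeq_of_le_tendsto_0 (fun N : ℕ => 1 / ((N : ℝ) + 1)
      + 1 / ((N : ℝ) + 1)) (fun k l N hk hl => ?_) ?_)
    · rw [dist_eq_norm]
      exact (hpair (hpos k) (hpos l) (hP k).1 (hP l).1 a).trans
        (add_le_add (Nat.one_div_le_one_div hk) (Nat.one_div_le_one_div hl))
    · simpa using (tendsto_one_div_add_atTop_nhds_zero_nat (𝕜 := ℝ)).add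
        (tendsto_one_div_add_atTop_nhds_zero_nat (𝕜 := ℝ))
  choose Φ hΦ using hlim
  refine ⟨Φ, fun ε hε => ⟨γ ε, hγ ε hε, fun Q hQ a => ?_⟩⟩
  refine le_of_tendsto_of_tendsto' ((hΦ a).const_sub (S Q a)).norm
    (((tendsto_one_div_add_atTop_nhds_zero_nat (𝕜 := ℝ)).const_add ε).trans (by simp))
    fun k => hpair hε (hpos k) hQ (hP k).1 a

/-- The indefinite integral of `f`. -/
noncomputable def primitive {n : ℕ} (f : (Fin n → ℝ) → ℂ) (a : Fin n → ℝ) : ℂ :=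
  hkIntegral ((Iic a).indicator f)

/-- A real point, as a point of `[-∞, ∞]ⁿ`. -/
def toExt {n : ℕ} (a : Fin n → ℝ) : Fin n → EReal := fun i => (a i : EReal)

lemma Cell.volumeBelow_mem {n : ℕ} {c : Cell n} (hl : IsFinitePoint c.lower)
    (hu : IsFinitePoint c.upper) (hlu : c.lower ≤ c.upper) (a : Fin n → ℝ) :
    0 ≤ c.volumeBelow (toExt a) ∧ c.volumeBelow (toExt a) ≤ c.volume := by
  have h : ∀ i, 0 ≤ (min (c.upper i) (toExt a i)).toReal - (min (c.lower i) (toExt a i)).toReal ∧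
      (min (c.upper i) (toExt a i)).toReal - (min (c.lower i) (toExt a i)).toReal ≤
        (c.upper i).toReal - (c.lower i).toReal := fun i => by
    have e1 := EReal.coe_toReal (hl i).2 (hl i).1
    have e2 := EReal.coe_toReal (hu i).2 (hu i).1
    have h12 := hlu i
    rw [← e1, ← e2] at h12 ⊢
    generalize (c.lower i).toReal = l at *
    generalize (c.upper i).toReal = u at *
    have h12 : l ≤ u := EReal.coe_le_coe_iff.1 h12
    simp only [toExt, ← EReal.coe_strictMono.monotone.map_min, EReal.toReal_coe]
    constructor
    · exact sub_nonneg.2 (min_le_min_right _ h12)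
    · rcases le_total l (a i) with h | h
      · rw [min_eq_left h]; exact sub_le_sub_right (min_le_left _ _) _
      · rw [min_eq_right h, min_eq_right (h.trans h12)]; linarith
  exact ⟨Finset.prod_nonneg fun i _ => (h i).1,
    Finset.prod_le_prod (fun i _ => (h i).1) fun i _ => (h i).2⟩

lemma norm_volumeBelow_mul_le {n : ℕ} {P : TaggedPartition n} (hP : P.IsBounded) {c : Cell n}
    (hc : c ∈ P.cells) (f : (Fin n → ℝ) → ℂ) (a : Fin n → ℝ) :
    ‖(c.volumeBelow (toExt a) : ℂ) * extendZero f c.tag‖ ≤ ‖c.term f‖ := by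
  by_cases ht : IsFinitePoint c.tag
  · obtain ⟨hl, hu⟩ := hP c hc ht
    have h := Cell.volumeBelow_mem hl hu (fun i => (P.lower_lt_upper c hc i).le) a
    rw [Cell.term, norm_mul, norm_mul, Complex.norm_real, Complex.norm_real,
      Real.norm_of_nonneg h.1, Real.norm_of_nonneg (h.1.trans h.2)]
    exact mul_le_mul_of_nonneg_right h.2 (norm_nonneg _)
  · simp [Cell.term, extendZero_of_not ht]

open Classical in
lemma extendZero_indicator {n : ℕ} (f : (Fin n → ℝ) → ℂ) (a : Fin n → ℝ) {x : Fin n → EReal}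
    (hx : IsFinitePoint x) :
    extendZero ((Iic a).indicator f) x = if x ≤ toExt a then extendZero f x else 0 := by
  rw [extendZero_of hx, extendZero_of hx, indicator_apply]
  have : (fun i => (x i).toReal) ∈ Iic a ↔ x ≤ toExt a := by
    refine forall_congr' fun i => ?_
    rw [← EReal.coe_le_coe_iff, EReal.coe_toReal (hx i).2 (hx i).1, toExt]
  simp only [this]

-- A cell meeting none of the hyperplanes is either wholly below `a`, where the two contributions
-- agree, or has a side wholly above `a i`, where both vanish. For a cell that does meet one, the
-- two weights lie between zero and the volume of the cell whenever its tag is finite.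
open Classical in
lemma norm_riemannSum_indicator_sub_le {n : ℕ} {P : TaggedPartition n} (hP : P.IsBounded)
    (f : (Fin n → ℝ) → ℂ) (a : Fin n → ℝ) :
    ‖P.riemannSum ((Iic a).indicator f) - P.sumBelow f (toExt a)‖ ≤
      ∑ c ∈ P.cells with ∃ i, c.Meets (toExt a) i, ‖c.term f‖ := by
  rw [TaggedPartition.riemannSum, TaggedPartition.sumBelow, ← Finset.sum_sub_distrib,
    Finset.sum_filter]
  refine (norm_sum_le _ _).trans (Finset.sum_le_sum fun c hc => ?_)
  by_cases ht : IsFinitePoint c.tag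
  swap
  · simp only [extendZero_of_not ht, mul_zero, sub_zero, norm_zero]
    split_ifs <;> positivity
  obtain ⟨hl, hu⟩ := hP c hc ht
  have hvol := Cell.volumeBelow_mem hl hu (fun i => (P.lower_lt_upper c hc i).le) a
  have htag := P.tag_mem c hc
  rw [extendZero_indicator f a ht]
  by_cases hm : ∃ i, c.Meets (toExt a) i
  · rw [if_pos hm]
    split_ifs
    · rw [← sub_mul, Cell.term, norm_mul, norm_mul, ← Complex.ofReal_sub, Complex.norm_real,
        Complex.norm_real, Real.norm_of_nonneg (sub_nonneg.2 hvol.2),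
        Real.norm_of_nonneg (hvol.1.trans hvol.2)]
      exact mul_le_mul_of_nonneg_right (by linarith) (norm_nonneg _)
    · rw [mul_zero, zero_sub, norm_neg]
      exact norm_volumeBelow_mul_le hP hc f a
  · rw [if_neg hm, norm_le_zero_iff, sub_eq_zero]
    have hm' : ∀ i, toExt a i < c.lower i ∨ c.upper i < toExt a i := fun i => by
      by_contra hcon
      push Not at hcon
      exact hm ⟨i, hcon.1, hcon.2⟩
    by_cases hall : ∀ i, c.upper i < toExt a i
    · rw [if_pos (show c.tag ≤ toExt a from fun i => (htag.2 i).trans (hall i).le)]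
      congr 2
      refine Finset.prod_congr rfl fun i _ => ?_
      rw [min_eq_left (hall i).le,
        min_eq_left ((P.lower_lt_upper c hc i).trans (hall i)).le]
    · push Not at hall
      obtain ⟨i, hi⟩ := hall
      have hi' := (hm' i).resolve_right (not_lt.2 hi)
      rw [if_neg fun h => not_lt.2 ((htag.1 i).trans (h i)) hi', mul_zero, Cell.volumeBelow,
        Finset.prod_eq_zero (Finset.mem_univ i)]
      · simp
      · rw [min_eq_right hi, min_eq_right hi'.le, sub_self]

-- This is the main statement about primitives: the sums over cells cut at `a` and the sums for the
-- truncated function converge to the same value, uniformly in `a`. In particular every truncation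
-- of `f` to a lower orthant is HK integrable.
open Classical in
lemma HKIntegrable.exists_gauge {n : ℕ} {f : (Fin n → ℝ) → ℂ} (hf : HKIntegrable f) {ε : ℝ}
    (hε : 0 < ε) :
    ∃ γ : (Fin n → EReal) → Set (Fin n → EReal), IsGauge γ ∧ ∀ P : TaggedPartition n,
      P.IsFine γ → P.IsBounded ∧ ∀ a : Fin n → ℝ,
        ‖P.sumBelow f (toExt a) - primitive f a‖ ≤ ε ∧
        ‖P.riemannSum ((Iic a).indicator f) - primitive f a‖ ≤ ε ∧
        ∑ c ∈ P.cells with ∃ i, c.Meets (toExt a) i, ‖c.term f‖ ≤ ε := by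
  obtain ⟨I, hI⟩ := hf
  have hS : ∀ ε : ℝ, 0 < ε → ∃ γ : (Fin n → EReal) → Set (Fin n → EReal), IsGauge γ ∧
      ∀ P P' : TaggedPartition n, P.IsFine γ → P'.IsFine γ → ∀ a : Fin n → ℝ,
        ‖P.sumBelow f (toExt a) - P'.sumBelow f (toExt a)‖ ≤ ε := by
    intro ε hε
    -- One factor `2` passes from distance to `I` to distance between two Riemann sums; the
    -- remaining `2 * 2 ^ n` is the loss in the truncated comparison.
    obtain ⟨γ, hγ, H⟩ := hI (ε / (2 * 2 * 2 ^ n)) (by positivity)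
    refine ⟨γ, hγ, fun P P' hP hP' a => ?_⟩
    refine (TaggedPartition.norm_sumBelow_sub_sumBelow_le hγ (fun Q Q' hQ hQ' => ?_) hP hP'
      (toExt a)).trans_eq (b := 2 * (2 ^ n * (2 * (ε / (2 * 2 * 2 ^ n))))) ?_
    · have h1 := H Q hQ
      have h2 := H Q' hQ'
      rw [norm_sub_rev] at h2
      linarith [norm_sub_le_norm_sub_add_norm_sub (Q.riemannSum f) I (Q'.riemannSum f)]
    · field_simp
  obtain ⟨Φ, hΦ⟩ := exists_uniform_limit hS
  have key : ∀ ε : ℝ, 0 < ε → ∃ γ : (Fin n → EReal) → Set (Fin n → EReal), IsGauge γ ∧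
      ∀ P : TaggedPartition n, P.IsFine γ → P.IsBounded ∧ ∀ a : Fin n → ℝ,
        ‖P.sumBelow f (toExt a) - Φ a‖ ≤ ε ∧
        ‖P.riemannSum ((Iic a).indicator f) - Φ a‖ ≤ ε ∧
        ∑ c ∈ P.cells with ∃ i, c.Meets (toExt a) i, ‖c.term f‖ ≤ ε := by
    intro ε hε
    obtain ⟨γ, hγ, H⟩ := hΦ (ε / 2) (half_pos hε)
    obtain ⟨γ', hγ', H'⟩ := exists_gauge_sum_meets_le f (half_pos hε)
    refine ⟨_, hγ.inter hγ', fun P hP => ?_⟩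
    have h1 := H P (hP.mono fun _ => inter_subset_left)
    obtain ⟨hb, h2⟩ := H' P (hP.mono fun _ => inter_subset_right)
    refine ⟨hb, fun a => ⟨(h1 a).trans (half_le_self hε.le), ?_,
      (h2 a).trans (half_le_self hε.le)⟩⟩
    have h3 := (norm_riemannSum_indicator_sub_le hb f a).trans (h2 a)
    linarith [h1 a, norm_sub_le_norm_sub_add_norm_sub (P.riemannSum ((Iic a).indicator f))
      (P.sumBelow f (toExt a)) (Φ a)]
  -- The uniform limit is a HK integral of the truncated function, and uniqueness identifies it with
  -- the chosen value.
  have hprim : primitive f = Φ := by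
    funext a
    refine HasHKIntegral.hkIntegral_eq fun ε hε => ?_
    obtain ⟨γ, hγ, H⟩ := key (ε / 2) (half_pos hε)
    exact ⟨γ, hγ, fun P hP => ((H P hP).2 a).2.1.trans_lt (half_lt_self hε)⟩
  rw [hprim]
  exact key ε hε

/-! ### Boundedness and measurability of the primitive -/

/-- The point is that the supremum is over a bounded set, since an unbounded real supremum would be
`0`. Boundedness follows from one fine partition: the primitive stays within `1` of truncated sums
that are bounded by a fixed finite sum. -/
lemma norm_primitive_le {n : ℕ} {f : (Fin n → ℝ) → ℂ} (hf : HKIntegrable f) (a : Fin n → ℝ) :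
    ‖primitive f a‖ ≤ alexiewiczNorm f := by
  obtain ⟨γ, hγ, H⟩ := hf.exists_gauge one_pos
  obtain ⟨P, hP, -⟩ := exists_isFine hγ ∅
  obtain ⟨hb, h⟩ := H P hP
  refine le_ciSup (f := fun a => ‖primitive f a‖) ⟨1 + ∑ c ∈ P.cells, ‖c.term f‖, ?_⟩ a
  rintro _ ⟨a, rfl⟩
  have h1 := (h a).1
  rw [norm_sub_rev] at h1
  have h2 : ‖P.sumBelow f (toExt a)‖ ≤ ∑ c ∈ P.cells, ‖c.term f‖ :=
    (norm_sum_le _ _).trans (Finset.sum_le_sum fun c hc => norm_volumeBelow_mul_le hb hc f a)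
  have h3 := norm_sub_norm_le (primitive f a) (P.sumBelow f (toExt a))
  simp only
  linarith

lemma Cell.measurable_volumeBelow {n : ℕ} (c : Cell n) :
    Measurable fun a : Fin n → ℝ => c.volumeBelow (toExt a) := by
  refine Finset.measurable_prod _ fun i _ => ?_
  have h : Measurable fun a : Fin n → ℝ => toExt a i :=
    measurable_coe_real_ereal.comp (measurable_pi_apply i)
  exact (measurable_ereal_toReal.comp (measurable_const.min h)).sub
    (measurable_ereal_toReal.comp (measurable_const.min h))

/-- The primitive is a pointwise limit of finite combinations of the measurable functions
`volumeBelow`. -/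
lemma measurable_primitive {n : ℕ} {f : (Fin n → ℝ) → ℂ} (hf : HKIntegrable f) :
    Measurable (primitive f) := by
  have hpos : ∀ k : ℕ, (0 : ℝ) < 1 / (k + 1) := fun k => Nat.one_div_pos_of_nat
  choose γ hγ H using fun k => hf.exists_gauge (hpos k)
  choose P hP using fun k => exists_isFine (hγ k) ∅
  refine measurable_of_tendsto_metrizable (f := fun k a => (P k).sumBelow f (toExt a))
    (fun k => ?_) ?_
  · exact Finset.measurable_sum _ fun c _ =>
      (Complex.measurable_ofReal.comp c.measurable_volumeBelow).mul_const _
  · refine tendsto_pi_nhds.2 fun a => tendsto_iff_norm_sub_tendsto_zero.2 ?_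
    exact squeeze_zero (fun _ => norm_nonneg _) (fun k => ((H k _ (hP k).1).2 a).1)
      tendsto_one_div_add_atTop_nhds_zero_nat

/-! ### Multipliers -/

lemma extendZero_mul {n : ℕ} (E f : (Fin n → ℝ) → ℂ) (x : Fin n → EReal) :
    extendZero (fun y => E y * f y) x = E (fun i => (x i).toReal) * extendZero f x := by
  by_cases hx : IsFinitePoint x
  · rw [extendZero_of hx, extendZero_of hx]
  · rw [extendZero_of_not hx, extendZero_of_not hx, mul_zero]

/-- A representation of the bounded function `E` as a superposition `∫ 1_{x ≤ t} ρ(t) dν(t)` of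
indicators of lower orthants, valid off the hyperplanes `x i = b i`. -/
structure TailRep {n : ℕ} (E : (Fin n → ℝ) → ℂ) (M : ℝ) where
  ν : Measure (Fin n → ℝ)
  sfinite : SFinite ν
  ρ : (Fin n → ℝ) → ℂ
  b : Fin n → ℝ
  integrable : Integrable ρ ν
  integral_norm_le : ∫ t, ‖ρ t‖ ∂ν ≤ M
  eq_integral : ∀ x, (∀ i, x i ≠ b i) → E x = ∫ t, (Ici x).indicator ρ t ∂ν
  norm_le : ∀ x, ‖E x‖ ≤ M

namespace TailRep

variable {n : ℕ} {E : (Fin n → ℝ) → ℂ} {M : ℝ} (R : TailRep E M)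

/-- The integral of `E · f`, in terms of the primitive `Φ` of `f`. -/
noncomputable def pairing (Φ : (Fin n → ℝ) → ℂ) : ℂ := ∫ t, R.ρ t * Φ t ∂(R.ν)

include R in
lemma bound_nonneg : 0 ≤ M := (norm_nonneg _).trans (R.norm_le 0)

lemma norm_integral_indicator_le (x : Fin n → ℝ) : ‖∫ t, (Ici x).indicator R.ρ t ∂(R.ν)‖ ≤ M := by
  refine le_trans ?_ R.integral_norm_le
  refine norm_integral_le_of_norm_le R.integrable.norm (Eventually.of_forall fun t => ?_)
  exact norm_indicator_le_norm_self _ _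

lemma integrable_mul {Φ : (Fin n → ℝ) → ℂ} (hΦ : Measurable Φ) {B : ℝ} (hB : ∀ t, ‖Φ t‖ ≤ B) :
    Integrable (fun t => R.ρ t * Φ t) R.ν :=
  R.integrable.mul_bdd hΦ.aestronglyMeasurable (Eventually.of_forall hB)

lemma norm_pairing_le {Φ : (Fin n → ℝ) → ℂ} {B : ℝ} (hB : ∀ t, ‖Φ t‖ ≤ B) :
    ‖R.pairing Φ‖ ≤ M * B := by
  have hB0 : 0 ≤ B := (norm_nonneg _).trans (hB 0)
  calc ‖R.pairing Φ‖ ≤ ∫ t, ‖R.ρ t‖ * B ∂(R.ν) := by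
        refine norm_integral_le_of_norm_le (R.integrable.norm.mul_const B)
          (Eventually.of_forall fun t => ?_)
        rw [norm_mul]
        exact mul_le_mul_of_nonneg_left (hB t) (norm_nonneg _)
    _ ≤ M * B := by
        rw [integral_mul_const]
        exact mul_le_mul_of_nonneg_right R.integral_norm_le hB0

lemma norm_pairing_sub_le {Φ Ψ : (Fin n → ℝ) → ℂ} (hΦ : Integrable (fun t => R.ρ t * Φ t) R.ν)
    (hΨ : Integrable (fun t => R.ρ t * Ψ t) R.ν) {B : ℝ} (hB : ∀ t, ‖Φ t - Ψ t‖ ≤ B) :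
    ‖R.pairing Φ - R.pairing Ψ‖ ≤ M * B := by
  rw [pairing, pairing, ← integral_sub hΦ hΨ]
  simp only [← mul_sub]
  exact R.norm_pairing_le hB

-- Integrating the Riemann sums of the truncations `1_{x ≤ t} f` against `ρ dν` reproduces the
-- Riemann sum of `E * f`, except at tags on the hyperplanes `x i = b i`. Uniform convergence
-- controls the integral, and the smallness of the cells meeting those hyperplanes controls the
-- exception.
open Classical in
lemma hasHKIntegral_mul {f : (Fin n → ℝ) → ℂ} (hf : HKIntegrable f) :
    HasHKIntegral (fun x => E x * f x) (R.pairing (primitive f)) := by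
  intro ε hε
  have hM := R.bound_nonneg
  -- The exceptional cells cost `2 * M * η` and the uniform approximation `M * η`; the extra `1`
  -- keeps the inequality strict and the denominator positive.
  set η := ε / (3 * M + 1) with hη
  have hη0 : 0 < η := by positivity
  obtain ⟨γ, hγ, H⟩ := hf.exists_gauge hη0
  refine ⟨γ, hγ, fun P hP => ?_⟩
  obtain ⟨-, h⟩ := H P hP
  have hterm : ∀ c : Cell n, Integrable (fun t => c.term f *
      (Ici fun i => (c.tag i).toReal).indicator R.ρ t) R.ν := fun c =>
    (R.integrable.indicator measurableSet_Ici).const_mul _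
  have hpt : ∀ t, R.ρ t * P.riemannSum ((Iic t).indicator f) = ∑ c ∈ P.cells, c.term f *
      (Ici fun i => (c.tag i).toReal).indicator R.ρ t := by
    intro t
    rw [TaggedPartition.riemannSum, Finset.mul_sum]
    refine Finset.sum_congr rfl fun c _ => ?_
    have e : (Iic t).indicator f = fun y => (Iic t).indicator 1 y * f y := by
      funext y; rw [indicator_apply, indicator_apply]; split_ifs <;> simp
    rw [e, extendZero_mul, Cell.term]
    by_cases ht : (fun i => (c.tag i).toReal) ≤ t
    · rw [indicator_of_mem (show _ ∈ Iic t from ht), indicator_of_mem (show t ∈ Ici _ from ht)]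
      simp only [Pi.one_apply]; ring
    · rw [indicator_of_notMem (show _ ∉ Iic t from ht), indicator_of_notMem (show t ∉ Ici _ from ht)]
      ring
  have h1 : R.pairing (fun t => P.riemannSum ((Iic t).indicator f)) = ∑ c ∈ P.cells, c.term f *
      ∫ t, (Ici fun i => (c.tag i).toReal).indicator R.ρ t ∂(R.ν) := by
    rw [pairing]
    simp only [hpt]
    rw [integral_finsetSum _ fun c _ => hterm c]
    exact Finset.sum_congr rfl fun c _ => integral_const_mul _ _
  have h2 : ‖R.pairing (fun t => P.riemannSum ((Iic t).indicator f)) -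
      R.pairing (primitive f)‖ ≤ M * η := by
    refine R.norm_pairing_sub_le ?_ (R.integrable_mul (measurable_primitive hf)
      (norm_primitive_le hf)) fun t => (h t).2.1
    simp only [hpt]
    exact integrable_finsetSum _ fun c _ => hterm c
  have h3 : ‖P.riemannSum (fun x => E x * f x) -
      R.pairing (fun t => P.riemannSum ((Iic t).indicator f))‖ ≤ 2 * M * η := by
    rw [h1, TaggedPartition.riemannSum, ← Finset.sum_sub_distrib]
    calc _ ≤ ∑ c ∈ P.cells, (if ∃ i, c.Meets (toExt R.b) i then 2 * M * ‖c.term f‖ else 0) := by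
          refine (norm_sum_le _ _).trans (Finset.sum_le_sum fun c hc => ?_)
          have e : (c.volume : ℂ) * extendZero (fun x => E x * f x) c.tag - c.term f *
              ∫ t, (Ici fun i => (c.tag i).toReal).indicator R.ρ t ∂(R.ν) =
              (E (fun i => (c.tag i).toReal) -
                ∫ t, (Ici fun i => (c.tag i).toReal).indicator R.ρ t ∂(R.ν)) * c.term f := by
            rw [extendZero_mul, Cell.term]; ring
          rw [e, norm_mul]
          split_ifs with hm
          · refine mul_le_mul_of_nonneg_right ((norm_sub_le _ _).trans ?_) (norm_nonneg _)
            linarith [R.norm_le fun i => (c.tag i).toReal,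
              R.norm_integral_indicator_le fun i => (c.tag i).toReal]
          -- A cell contains its tag, so a cell that avoids the hyperplanes has its tag off them and
          -- the representation of `E` is exact there.
          · by_cases ht : IsFinitePoint c.tag
            · rw [R.eq_integral, sub_self, norm_zero, zero_mul]
              intro i hi
              refine hm ⟨i, ?_⟩
              have : toExt R.b i = c.tag i := by
                rw [toExt, ← hi, EReal.coe_toReal (ht i).2 (ht i).1]
              rw [Cell.Meets, this]
              exact ⟨(P.tag_mem c hc).1 i, (P.tag_mem c hc).2 i⟩
            · rw [Cell.term, extendZero_of_not ht]; simp
      _ = 2 * M * ∑ c ∈ P.cells with ∃ i, c.Meets (toExt R.b) i, ‖c.term f‖ := by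
          rw [Finset.mul_sum, Finset.sum_filter]
      _ ≤ 2 * M * η := mul_le_mul_of_nonneg_left (h R.b).2.2 (by positivity)
  calc _ ≤ 2 * M * η + M * η :=
        (norm_sub_le_norm_sub_add_norm_sub _ _ _).trans (add_le_add h3 h2)
    _ < (3 * M + 1) * η := by linarith
    _ = ε := by rw [hη]; field_simp

include R in
lemma ae_eq_integral : ∀ᵐ x : Fin n → ℝ, E x = ∫ t, (Ici x).indicator R.ρ t ∂(R.ν) := by
  have : ∀ᵐ x : Fin n → ℝ, ∀ i, x i ≠ R.b i := ae_all_iff.2 fun i =>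
    Measure.ae_eval_ne (μ := fun _ : Fin n => (volume : Measure ℝ)) i (R.b i)
  filter_upwards [this] with x hx using R.eq_integral x hx

/-- This is Fubini's theorem on the set `x ≤ t`; the exceptional hyperplanes are Lebesgue null. -/
lemma integral_mul_eq {g : (Fin n → ℝ) → ℂ} (hg : Integrable g) :
    ∫ x, E x * g x = R.pairing fun t => ∫ x, (Iic t).indicator g x := by
  have := R.sfinite
  have h1 : Integrable (fun p : (Fin n → ℝ) × (Fin n → ℝ) =>
      {p : (Fin n → ℝ) × (Fin n → ℝ) | p.1 ≤ p.2}.indicator (fun p => g p.1 * R.ρ p.2) p)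
      (volume.prod R.ν) :=
    (hg.mul_prod R.integrable).indicator (isClosed_le continuous_fst continuous_snd).measurableSet
  have h2 := integral_integral_swap (f := fun x t => {p : (Fin n → ℝ) × (Fin n → ℝ) | p.1 ≤ p.2}.indicator
    (fun p => g p.1 * R.ρ p.2) (x, t)) h1
  calc ∫ x, E x * g x = ∫ x, ∫ t, {p : (Fin n → ℝ) × (Fin n → ℝ) | p.1 ≤ p.2}.indicator
          (fun p => g p.1 * R.ρ p.2) (x, t) ∂(R.ν) := by
        refine integral_congr_ae ?_
        filter_upwards [R.ae_eq_integral] with x hx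
        rw [hx, mul_comm, ← integral_const_mul]
        refine integral_congr_ae (Eventually.of_forall fun t => ?_)
        by_cases h : x ≤ t
        · simp [indicator, h]
        · simp [indicator, h]
    _ = _ := h2
    _ = _ := by
        refine integral_congr_ae (Eventually.of_forall fun t => ?_)
        simp only
        rw [← integral_const_mul]
        refine integral_congr_ae (Eventually.of_forall fun x => ?_)
        by_cases h : x ≤ t
        · simp [indicator, h, mul_comm]
        · simp [indicator, h]

end TailRep

/-! ### Step functions -/

/-- The half-open box of `ℝⁿ` with the finite endpoints of `c`. -/
def Cell.box {n : ℕ} (c : Cell n) : Set (Fin n → ℝ) :=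
  univ.pi fun i => Ioc (c.lower i).toReal (c.upper i).toReal

/-- The step function whose value on each cell is the value of `f` at the tag. -/
noncomputable def TaggedPartition.step {n : ℕ} (P : TaggedPartition n) (f : (Fin n → ℝ) → ℂ)
    (x : Fin n → ℝ) : ℂ :=
  ∑ c ∈ P.cells, c.box.indicator (fun _ => extendZero f c.tag) x

lemma Cell.measurableSet_box {n : ℕ} (c : Cell n) : MeasurableSet c.box :=
  MeasurableSet.univ_pi fun _ => measurableSet_Ioc

lemma Cell.integrable_indicator_box {n : ℕ} (c : Cell n) (z : ℂ) :
    Integrable (c.box.indicator fun _ => z) := by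
  refine (integrable_indicator_iff c.measurableSet_box).2 (integrableOn_const (hs := ?_))
  rw [Cell.box, Real.volume_pi_Ioc]
  exact ENNReal.prod_ne_top fun i _ => ENNReal.ofReal_ne_top

lemma TaggedPartition.integrable_step {n : ℕ} (P : TaggedPartition n) (f : (Fin n → ℝ) → ℂ) :
    Integrable (P.step f) :=
  integrable_finsetSum _ fun c _ => c.integrable_indicator_box _

lemma Cell.volumeBelow_eq_measure {n : ℕ} {c : Cell n} (hl : IsFinitePoint c.lower)
    (hu : IsFinitePoint c.upper) (hlu : c.lower ≤ c.upper) (t : Fin n → ℝ) :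
    (MeasureTheory.volume : Measure (Fin n → ℝ)).real (Iic t ∩ c.box) = c.volumeBelow (toExt t) := by
  have e1 := fun i => EReal.coe_toReal (hl i).2 (hl i).1
  have e2 := fun i => EReal.coe_toReal (hu i).2 (hu i).1
  have hlu' : ∀ i, (c.lower i).toReal ≤ (c.upper i).toReal := fun i => by
    rw [← EReal.coe_le_coe_iff, e1, e2]; exact hlu i
  have hfac : ∀ i, (min (c.upper i) (toExt t i)).toReal - (min (c.lower i) (toExt t i)).toReal =
      min (c.upper i).toReal (t i) - min (c.lower i).toReal (t i) := fun i => by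
    nth_rw 1 [← e1, ← e2]
    simp only [toExt, ← EReal.coe_strictMono.monotone.map_min, EReal.toReal_coe]
  rw [Cell.volumeBelow, Finset.prod_congr rfl fun i _ => hfac i]
  have hset : Iic t ∩ c.box =
      univ.pi fun i => Ioc (c.lower i).toReal (min (c.upper i).toReal (t i)) := by
    ext x
    simp only [Cell.box, mem_inter_iff, mem_Iic, Set.mem_pi, mem_univ, true_imp_iff, mem_Ioc, le_min_iff,
      Pi.le_def]
    exact ⟨fun h i => ⟨(h.2 i).1, (h.2 i).2, h.1 i⟩,
      fun h => ⟨fun i => (h i).2.2, fun i => ⟨(h i).1, (h i).2.1⟩⟩⟩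
  rw [hset]
  by_cases hall : ∀ i, (c.lower i).toReal ≤ t i
  · rw [measureReal_def, Real.volume_pi_Ioc_toReal fun i => le_min (hlu' i) (hall i)]
    exact Finset.prod_congr rfl fun i _ => by rw [min_eq_left (hall i)]
  · push Not at hall
    obtain ⟨i, hi⟩ := hall
    have hempty : (univ.pi fun i => Ioc (c.lower i).toReal (min (c.upper i).toReal (t i))) = ∅ :=
      Set.univ_pi_eq_empty (i := i) (Ioc_eq_empty (not_lt.2 ((min_le_right _ _).trans hi.le)))
    rw [hempty,
      Finset.prod_eq_zero (Finset.mem_univ i), measureReal_empty]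
    rw [min_eq_right hi.le, min_eq_right (hi.le.trans (hlu' i)), sub_self]

/-- The identity is exact. A cell with an infinite endpoint has an infinite tag by `hP`, so the step
value there is zero and the real endpoints assigned to it are irrelevant. -/
lemma TaggedPartition.integral_step {n : ℕ} {P : TaggedPartition n} (hP : P.IsBounded)
    (f : (Fin n → ℝ) → ℂ) (t : Fin n → ℝ) :
    ∫ x, (Iic t).indicator (P.step f) x = P.sumBelow f (toExt t) := by
  rw [integral_indicator measurableSet_Iic]
  simp only [TaggedPartition.step]
  rw [integral_finsetSum _ fun c _ => (c.integrable_indicator_box _).integrableOn,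
    TaggedPartition.sumBelow]
  refine Finset.sum_congr rfl fun c hc => ?_
  by_cases ht : IsFinitePoint c.tag
  · obtain ⟨hl, hu⟩ := hP c hc ht
    rw [integral_indicator c.measurableSet_box, Measure.restrict_restrict c.measurableSet_box,
      setIntegral_const, inter_comm,
      Cell.volumeBelow_eq_measure hl hu fun i => (P.lower_lt_upper c hc i).le]
    simp
  · simp [extendZero_of_not ht]

/-- The step function is chosen before `E`: its primitive approximates that of `f` uniformly, so one
function serves all the test functions at once. -/
lemma exists_step_approx {n : ℕ} {f : (Fin n → ℝ) → ℂ} (hf : HKIntegrable f) {ε : ℝ}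
    (hε : 0 < ε) : ∃ s : (Fin n → ℝ) → ℂ, Integrable s ∧ ∀ (E : (Fin n → ℝ) → ℂ) (M : ℝ)
      (R : TailRep E M), ‖(∫ x, E x * s x) - R.pairing (primitive f)‖ ≤ M * ε := by
  obtain ⟨γ, hγ, H⟩ := hf.exists_gauge hε
  obtain ⟨P, hP, -⟩ := exists_isFine hγ ∅
  obtain ⟨hb, h⟩ := H P hP
  refine ⟨P.step f, P.integrable_step f, fun E M R => ?_⟩
  rw [R.integral_mul_eq (P.integrable_step f)]
  simp only [TaggedPartition.integral_step hb]
  refine R.norm_pairing_sub_le ?_ (R.integrable_mul (measurable_primitive hf)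
    (norm_primitive_le hf)) fun t => (h t).1
  refine R.integrable_mul (B := ∑ c ∈ P.cells, ‖c.term f‖) ?_ fun t =>
    (norm_sum_le _ _).trans (Finset.sum_le_sum fun c hc => norm_volumeBelow_mul_le hb hc f t)
  exact Finset.measurable_sum _ fun c _ =>
    (Complex.measurable_ofReal.comp c.measurable_volumeBelow).mul_const _

/-! ### Elements of `SD²` -/

namespace PreSD

variable {n d : ℕ} (T : TestFields n d)

lemma summable_norm_sq (x : PreSD T) : Summable fun m => weight m * ‖F T m x‖ ^ 2 := by
  refine (Complex.reCLM.summable (summable_inner T x x)).congr fun m => ?_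
  rw [Complex.reCLM_apply, Complex.mul_conj, ← Complex.ofReal_mul, Complex.ofReal_re,
    Complex.normSq_eq_norm_sq]

/-- The squared norm is an average of the squares `‖F T m x‖ ^ 2`, because the weights have sum one.
-/
lemma norm_le_of_forall_norm_F_le {x : PreSD T} {b : ℝ} (h : ∀ m, ‖F T m x‖ ≤ b) : ‖x‖ ≤ b := by
  have hb : 0 ≤ b := (norm_nonneg _).trans (h 0)
  refine (sq_le_sq₀ (norm_nonneg _) hb).1 ?_
  calc ‖x‖ ^ 2 = ∑' m, weight m * ‖F T m x‖ ^ 2 := norm_sq T x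
    _ ≤ ∑' m, weight m * b ^ 2 := (summable_norm_sq T x).tsum_le_tsum (fun m =>
        mul_le_mul_of_nonneg_left (pow_le_pow_left₀ (norm_nonneg _) (h m) 2) (weight_pos m).le)
        (summable_weight.mul_right _)
    _ = b ^ 2 := by rw [tsum_mul_right, tsum_weight, one_mul]

end PreSD

namespace SD2

variable {n d : ℕ} (T : TestFields n d)

lemma F_coe (m : ℕ) (x : PreSD T) : SD2.F T m (x : SD2 T) = PreSD.F T m x :=
  ContinuousLinearMap.fromCompletion_apply_coe _ _

lemma sum_norm_F_sq_le (s : Finset ℕ) (x : SD2 T) :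
    ∑ m ∈ s, weight m * ‖SD2.F T m x‖ ^ 2 ≤ ‖x‖ ^ 2 := by
  induction x using UniformSpace.Completion.induction_on with
  | hp => exact isClosed_le (by fun_prop) (by fun_prop)
  | ih x =>
    simp only [F_coe, UniformSpace.Completion.norm_coe]
    rw [PreSD.norm_sq]
    exact (PreSD.summable_norm_sq T x).sum_le_tsum s fun m _ =>
      mul_nonneg (weight_pos m).le (sq_nonneg _)

/-- If `w` is killed by every functional and `z` in `L¹` is near `w`, then `z` and `z - w` have the
same coordinates. Hence `‖z‖ ≤ ‖z - w‖`, and `‖w‖` is at most twice this small quantity. -/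
lemma ext_of_F {x y : SD2 T} (h : ∀ m, SD2.F T m x = SD2.F T m y) : x = y := by
  refine eq_of_norm_sub_le_zero (le_of_forall_pos_le_add fun ε hε => ?_)
  set w := x - y with hw
  have hF : ∀ m, SD2.F T m w = 0 := fun m => by rw [hw, map_sub, h m, sub_self]
  obtain ⟨z, hz⟩ := Metric.denseRange_iff.1 (UniformSpace.Completion.denseRange_coe
    (α := PreSD T)) w (ε / 2) (half_pos hε)
  rw [dist_eq_norm] at hz
  have hzn : ‖z‖ ^ 2 ≤ ‖(z : SD2 T) - w‖ ^ 2 := by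
    rw [PreSD.norm_sq]
    refine (PreSD.summable_norm_sq T z).tsum_le_of_sum_le fun s => ?_
    have := sum_norm_F_sq_le T s ((z : SD2 T) - w)
    simpa only [map_sub, hF, sub_zero, F_coe] using this
  have h1 : ‖z‖ ≤ ‖w - (z : SD2 T)‖ := by
    rw [norm_sub_rev]
    exact (sq_le_sq₀ (norm_nonneg _) (norm_nonneg _)).1 hzn
  have h2 := norm_sub_norm_le w (z : SD2 T)
  rw [UniformSpace.Completion.norm_coe] at h2
  linarith

/-- Uniform convergence of the coordinates forces convergence in norm, again because the weights
have sum one. -/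
lemma exists_of_approx {L : ℕ → ℂ} {A B : ℝ} (hL : ∀ m, ‖L m‖ ≤ A) (x : ℕ → PreSD T)
    (hx : ∀ k m, ‖PreSD.F T m (x k) - L m‖ ≤ B * (1 / ((k : ℝ) + 1))) :
    ∃ u : SD2 T, (∀ m, SD2.F T m u = L m) ∧ ‖u‖ ≤ A := by
  have hB : 0 ≤ B := by simpa using (norm_nonneg _).trans (hx 0 0)
  have hlim : Tendsto (fun k : ℕ => B * (1 / ((k : ℝ) + 1))) atTop (𝓝 0) := by
    simpa using (tendsto_one_div_add_atTop_nhds_zero_nat (𝕜 := ℝ)).const_mul B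
  have hc : CauchySeq fun k => (x k : SD2 T) := by
    refine cauchySeq_of_le_tendsto_0 (fun N : ℕ => B * (1 / ((N : ℝ) + 1)) +
      B * (1 / ((N : ℝ) + 1))) (fun k l N hk hl => ?_) (by simpa using hlim.add hlim)
    rw [UniformSpace.Completion.dist_eq, dist_eq_norm]
    refine PreSD.norm_le_of_forall_norm_F_le T fun m => ?_
    rw [map_sub]
    have h1 := (hx k m).trans (mul_le_mul_of_nonneg_left (Nat.one_div_le_one_div hk) hB)
    have h2 := (hx l m).trans (mul_le_mul_of_nonneg_left (Nat.one_div_le_one_div hl) hB)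
    rw [norm_sub_rev] at h2
    exact (norm_sub_le_norm_sub_add_norm_sub _ (L m) _).trans (add_le_add h1 h2)
  obtain ⟨u, hu⟩ := cauchySeq_tendsto_of_complete hc
  refine ⟨u, fun m => ?_, ?_⟩
  · refine tendsto_nhds_unique (((SD2.F T m).continuous.tendsto u).comp hu) ?_
    simp only [Function.comp_def, F_coe]
    exact tendsto_iff_norm_sub_tendsto_zero.2
      (squeeze_zero (fun _ => norm_nonneg _) (fun k => hx k m) hlim)
  · refine le_of_tendsto_of_tendsto' hu.norm
      ((hlim.const_add A).trans (by simp)) fun k => ?_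
    rw [UniformSpace.Completion.norm_coe]
    refine PreSD.norm_le_of_forall_norm_F_le T fun m => ?_
    have := norm_sub_norm_le (PreSD.F T m (x k)) (L m)
    linarith [hx k m, hL m]

end SD2

/-! ### Representation of integrable functions -/

lemma hasHKIntegral_zero {n : ℕ} : HasHKIntegral (fun _ : Fin n → ℝ => (0 : ℂ)) 0 := by
  intro ε hε
  refine ⟨fun _ => univ, fun _ => ⟨isOpen_univ, trivial⟩, fun P _ => ?_⟩
  have : ∀ x, extendZero (fun _ : Fin n → ℝ => (0 : ℂ)) x = 0 := fun x => by
    unfold extendZero; split_ifs <;> rfl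
  simpa [TaggedPartition.riemannSum, this] using hε

lemma HasHKIntegral.add {n : ℕ} {f f' : (Fin n → ℝ) → ℂ} {I I' : ℂ} (h : HasHKIntegral f I)
    (h' : HasHKIntegral f' I') : HasHKIntegral (fun x => f x + f' x) (I + I') := by
  intro ε hε
  obtain ⟨γ, hγ, H⟩ := h (ε / 2) (half_pos hε)
  obtain ⟨γ', hγ', H'⟩ := h' (ε / 2) (half_pos hε)
  refine ⟨_, IsGauge.inter hγ hγ', fun P hP => ?_⟩
  have h1 := H P (hP.mono fun _ => inter_subset_left)
  have h2 := H' P (hP.mono fun _ => inter_subset_right)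
  have e : P.riemannSum (fun x => f x + f' x) = P.riemannSum f + P.riemannSum f' := by
    simp only [TaggedPartition.riemannSum]
    rw [← Finset.sum_add_distrib]
    refine Finset.sum_congr rfl fun c _ => ?_
    rw [← mul_add]
    congr 1
    unfold extendZero
    split_ifs <;> simp
  rw [e, add_sub_add_comm]
  linarith [norm_add_le (P.riemannSum f - I) (P.riemannSum f' - I')]

lemma HasHKIntegral.sum {n : ℕ} {ι : Type*} {s : Finset ι} {f : ι → (Fin n → ℝ) → ℂ} {I : ι → ℂ}
    (h : ∀ j ∈ s, HasHKIntegral (f j) (I j)) :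
    HasHKIntegral (fun x => ∑ j ∈ s, f j x) (∑ j ∈ s, I j) := by
  classical
  induction s using Finset.induction_on with
  | empty => simpa using hasHKIntegral_zero
  | insert j s hj ih =>
    simp only [Finset.sum_insert hj]
    exact (h j (Finset.mem_insert_self _ _)).add
      (ih fun i hi => h i (Finset.mem_insert_of_mem hi))

lemma exists_represents {n d : ℕ} (T : TestFields n d) {M : ℝ}
    (R : ∀ m j, TailRep (fun x => T.E m x j) M) {f : (Fin n → ℝ) → Fin d → ℂ}
    (hf : ∀ j, HKIntegrable fun x => f x j) :
    ∃ u : SD2 T, Represents T f u ∧ (∀ v, Represents T f v → v = u) ∧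
      ‖u‖ ≤ M * ∑ j, alexiewiczNorm fun x => f x j := by
  have hpos : ∀ k : ℕ, (0 : ℝ) < 1 / (k + 1) := fun k => Nat.one_div_pos_of_nat
  -- The approximants do not depend on `m`, so the convergence of the functionals is uniform in `m`.
  choose s hs hsR using fun k j => exists_step_approx (hf j) (hpos k)
  let L : ℕ → ℂ := fun m => ∑ j, (R m j).pairing (primitive fun x => f x j)
  have hL : ∀ m, HasHKIntegral (fun x => ∑ j, T.E m x j * f x j) (L m) := fun m =>
    HasHKIntegral.sum fun j _ => (R m j).hasHKIntegral_mul (hf j)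
  have hLn : ∀ m, ‖L m‖ ≤ M * ∑ j, alexiewiczNorm fun x => f x j := fun m => by
    rw [Finset.mul_sum]
    exact (norm_sum_le _ _).trans (Finset.sum_le_sum fun j _ =>
      (R m j).norm_pairing_le (norm_primitive_le (hf j)))
  let S : ℕ → (Fin n → ℝ) → EuclideanSpace ℂ (Fin d) := fun k x => WithLp.toLp 2 fun j => s k j x
  have hS : ∀ k, Integrable (S k) := fun k => by
    have h : Integrable fun x => fun j => s k j x := Integrable.of_eval fun j => hs k j
    exact ((EuclideanSpace.equiv (Fin d) ℂ).symm :
      (Fin d → ℂ) →L[ℂ] EuclideanSpace ℂ (Fin d)).integrable_comp h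
  have hF : ∀ k m, PreSD.F T m ((hS k).toL1 (S k) : VectorL1 n d) =
      ∑ j, ∫ x, T.E m x j * s k j x := fun k m => by
    obtain ⟨B, hB⟩ := T.bounded
    rw [← integral_finsetSum _ fun j _ => (hs k j).bdd_mul
      (T.measurable m j).aestronglyMeasurable (Eventually.of_forall fun x => hB m x j)]
    refine integral_congr_ae ?_
    filter_upwards [(hS k).coeFn_toL1] with x hx
    rw [hx]
  obtain ⟨u, hu, hun⟩ := SD2.exists_of_approx T (B := d * M) hLn
    (fun k => ((hS k).toL1 (S k) : VectorL1 n d)) fun k m => by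
      rw [hF, ← Finset.sum_sub_distrib]
      refine (norm_sum_le _ _).trans ((Finset.sum_le_sum fun j _ => hsR k j _ M (R m j)).trans_eq ?_)
      simp [mul_assoc]
  refine ⟨u, fun m => by rw [hu]; exact hL m, fun v hv => ?_, hun⟩
  exact SD2.ext_of_F T fun m => ((hv m).unique (hL m)).trans (hu m).symm

/-! ### Superpositions of half-lines -/

/-- A representation of `φ` as `∫ 1_{x ≤ t} ρ(t) dν(t)`, valid for `x ≠ b`. -/
structure LineTailRep (φ : ℝ → ℂ) (M : ℝ) where
  ν : Measure ℝ
  sigmaFinite : SigmaFinite ν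
  ρ : ℝ → ℂ
  b : ℝ
  integrable : Integrable ρ ν
  integral_norm_le : ∫ t, ‖ρ t‖ ∂ν ≤ M
  eq_integral : ∀ x, x ≠ b → φ x = ∫ t, (Ici x).indicator ρ t ∂ν
  norm_le : ∀ x, ‖φ x‖ ≤ M

/-- Products of superpositions of half-lines are superpositions of lower orthants. -/
noncomputable def LineTailRep.prod {n : ℕ} {φ : Fin n → ℝ → ℂ} {M : ℝ}
    (R : ∀ l, LineTailRep (φ l) M) : TailRep (fun x => ∏ l, φ l (x l)) (M ^ n) where
  ν := Measure.pi fun l => (R l).ν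
  sfinite := by
    have := fun l => (R l).sigmaFinite
    infer_instance
  ρ t := ∏ l, (R l).ρ (t l)
  b l := (R l).b
  integrable := by
    have := fun l => (R l).sigmaFinite
    exact Integrable.fintype_prod fun l => (R l).integrable
  integral_norm_le := by
    have := fun l => (R l).sigmaFinite
    simp only [norm_prod]
    rw [integral_fintype_prod_eq_prod (𝕜 := ℝ) fun l t => ‖(R l).ρ t‖]
    refine (Finset.prod_le_prod (fun l _ => integral_nonneg fun t => norm_nonneg _)
      fun l _ => (R l).integral_norm_le).trans ?_
    simp
  eq_integral x hx := by
    have := fun l => (R l).sigmaFinite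
    rw [Finset.prod_congr rfl fun l _ => (R l).eq_integral (x l) (hx l),
      ← integral_fintype_prod_eq_prod fun l t => (Ici (x l)).indicator (R l).ρ t]
    refine integral_congr_ae (Eventually.of_forall fun t => ?_)
    by_cases h : x ≤ t
    · simp only [indicator_of_mem (show t ∈ Ici x from h)]
      exact Finset.prod_congr rfl fun l _ => indicator_of_mem (show t l ∈ Ici (x l) from h l) _
    · simp only [indicator_of_notMem (show t ∉ Ici x from h)]
      obtain ⟨l, hl⟩ := not_forall.1 h
      exact Finset.prod_eq_zero (Finset.mem_univ l)
        (indicator_of_notMem (show t l ∉ Ici (x l) from hl) _)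
  norm_le x := by
    rw [norm_prod]
    refine (Finset.prod_le_prod (fun l _ => norm_nonneg _) fun l _ => (R l).norm_le _).trans ?_
    simp

open Classical in
/-- A continuously differentiable function, cut off outside an interval, is a superposition of
half-lines. -/
noncomputable def LineTailRep.ofInterval {φ ψ ψ' : ℝ → ℂ} {a b M : ℝ} (hab : a < b)
    (hψ : ∀ t, HasDerivAt ψ (ψ' t) t) (hψ' : Continuous ψ')
    (hφ : ∀ t ∈ Icc a b, φ t = ψ t) (hφ0 : ∀ t ∉ Icc a b, φ t = 0)
    (hV : ‖ψ a‖ + ‖ψ b‖ + ∫ t in a..b, ‖ψ' t‖ ≤ M) (hM : ∀ t, ‖φ t‖ ≤ M) :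
    LineTailRep φ M := by
  -- The density is minus the derivative of the cut-off function: `-ψ'` inside, and at the ends the
  -- masses for the jump up by `ψ a` and the jump down by `ψ b`.
  let ρ : ℝ → ℂ := fun t => if t = a then -ψ a else if t = b then ψ b else -ψ' t
  have hρa : ρ a = -ψ a := if_pos rfl
  have hρb : ρ b = ψ b := by simp [ρ, hab.ne']
  have hρ : EqOn ρ (fun t => -ψ' t) (Ioo a b) := fun t ht => by
    simp [ρ, ht.1.ne', ht.2.ne]
  have hint : Integrable ρ (volume.restrict (Ioo a b)) :=
    IntegrableOn.congr_fun (hψ'.neg.integrableOn_Icc.mono_set Ioo_subset_Icc_self) hρ.symm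
      measurableSet_Ioo
  have hdirac : ∀ (c : ℝ) (g : ℝ → ℂ), Integrable g (Measure.dirac c) := fun c g =>
    integrable_dirac (by simp)
  exact
  { ν := volume.restrict (Ioo a b) + Measure.dirac a + Measure.dirac b
    sigmaFinite := inferInstance
    ρ := ρ
    -- For `x` in `(a, b]` the tail is `ψ b - ∫ ψ'` over `(x, b)`, which is `ψ x`; at `x = a` the
    -- mass at `a` is also counted and the tail is `0`, so this point is excluded.
    b := a
    integrable := (hint.add_measure (hdirac a ρ)).add_measure (hdirac b ρ)
    integral_norm_le := by
      rw [integral_add_measure (hint.add_measure (hdirac a ρ)).norm (hdirac b ρ).norm,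
        integral_add_measure hint.norm (hdirac a ρ).norm, integral_dirac, integral_dirac, hρa, hρb,
        norm_neg, setIntegral_congr_fun measurableSet_Ioo (g := fun t => ‖ψ' t‖) fun t ht => by
          simp only [hρ ht, norm_neg],
        ← integral_Ioc_eq_integral_Ioo, ← intervalIntegral.integral_of_le hab.le]
      linarith
    eq_integral := fun x hx => by
      have hi : ∀ {μ : Measure ℝ}, Integrable ρ μ → Integrable ((Ici x).indicator ρ) μ :=
        fun h => h.indicator measurableSet_Ici
      have hftc : ∀ c ∈ Icc a b, ∫ t in Ioo c b, ρ t = -(ψ b - ψ c) := fun c hc => by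
        rw [setIntegral_congr_fun measurableSet_Ioo (hρ.mono (Ioo_subset_Ioo_left hc.1)),
          ← integral_Ioc_eq_integral_Ioo, ← intervalIntegral.integral_of_le hc.2,
          intervalIntegral.integral_neg, intervalIntegral.integral_eq_sub_of_hasDerivAt
            (fun t _ => hψ t) (hψ'.intervalIntegrable _ _)]
      rw [integral_add_measure (hi (hint.add_measure (hdirac a ρ))) (hi (hdirac b ρ)),
        integral_add_measure (hi hint) (hi (hdirac a ρ)), integral_dirac, integral_dirac,
        setIntegral_indicator measurableSet_Ici]
      rcases lt_or_gt_of_ne hx with hxa | hxa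
      · have e : Ioo a b ∩ Ici x = Ioo a b :=
          inter_eq_left.2 fun t ht => hxa.le.trans ht.1.le
        rw [e, hftc a ⟨le_rfl, hab.le⟩, indicator_of_mem (show a ∈ Ici x from hxa.le),
          indicator_of_mem (show b ∈ Ici x from (hxa.trans hab).le), hρa, hρb,
          hφ0 x fun h => not_lt.2 h.1 hxa]
        ring
      · rw [indicator_of_notMem (show a ∉ Ici x from not_le.2 hxa)]
        rcases le_or_gt x b with hxb | hxb
        · have e : Ioo a b ∩ Ici x = Ico x b := by
            ext t
            exact ⟨fun h => ⟨h.2, h.1.2⟩, fun h => ⟨⟨hxa.trans_le h.1, h.2⟩, h.1⟩⟩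
          rw [e, integral_Ico_eq_integral_Ioo, hftc x ⟨hxa.le, hxb⟩,
            indicator_of_mem (show b ∈ Ici x from hxb), hρb, hφ x ⟨hxa.le, hxb⟩]
          ring
        · have e : Ioo a b ∩ Ici x = ∅ :=
            eq_empty_of_forall_notMem fun t h => not_lt.2 (h.1.2.le.trans hxb.le) (by
              have := h.2; exact absurd (h.1.2.trans hxb) (not_lt.2 this))
          rw [e, indicator_of_notMem (show b ∉ Ici x from not_le.2 hxb),
            hφ0 x fun h => not_lt.2 h.2 hxb]
          simp
    norm_le := hM }

/-! ### The functions `ξ_k` -/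

/-- On its support `hk` is an exponential, so the factor depending on `y` comes out and the
convolution becomes an integral over a moving window, differentiable by the fundamental theorem of
calculus. -/
lemma chi_eq_integral (k : ℕ) (y : ℝ) : chi k y =
    (Real.Gamma (1 / expo k + 1) : ℂ) * Complex.exp (-(Complex.I * y)) *
      ∫ w in (y - 2 * eps k)..(y + 2 * eps k),
        (mollifier k w : ℂ) * Complex.exp (Complex.I * w) := by
  have he := eps_pos k
  have h1 : chi k y = ∫ z : ℝ, (mollifier k z : ℂ) * hk k (y - z) := by
    rw [chi, ← integral_sub_left_eq_self _ volume y]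
    simp
  rw [h1, intervalIntegral.integral_of_le (by linarith), integral_Ioc_eq_integral_Ioo,
    ← integral_indicator measurableSet_Ioo, ← integral_const_mul]
  refine integral_congr_ae (Eventually.of_forall fun z => ?_)
  have hiff : |y - z| < 2 * eps k ↔ z ∈ Ioo (y - 2 * eps k) (y + 2 * eps k) := by
    rw [abs_lt, mem_Ioo]
    constructor <;> rintro ⟨h, h'⟩ <;> constructor <;> linarith
  simp only [hk_eq, indicator_apply, hiff]
  split_ifs
  · have e : -(Complex.I * ((y - z : ℝ) : ℂ)) = -(Complex.I * y) + Complex.I * z := by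
      push_cast; ring
    rw [e, Complex.exp_add]; ring
  · simp

lemma chi_eq_zero {k : ℕ} {y : ℝ} (hy : 3 * eps k < |y|) : chi k y = 0 := by
  rw [chi]
  refine integral_eq_zero_of_ae (Eventually.of_forall fun z => ?_)
  by_cases hz : |z| < 2 * eps k
  · have h := abs_sub_abs_le_abs_sub y z
    simp [mollifier_zero_of_le (k := k) (x := y - z) (by linarith)]
  · simp [hk_eq, hz]

/-- The derivative of `χ_k`. -/
noncomputable def chiDeriv (k : ℕ) (y : ℝ) : ℂ :=
  -Complex.I * chi k y + (Real.Gamma (1 / expo k + 1) : ℂ) * Complex.exp (-(Complex.I * y)) *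
    ((mollifier k (y + 2 * eps k) : ℂ) * Complex.exp (Complex.I * (y + 2 * eps k : ℝ)) -
      (mollifier k (y - 2 * eps k) : ℂ) * Complex.exp (Complex.I * (y - 2 * eps k : ℝ)))

lemma hasDerivAt_chi (k : ℕ) (y : ℝ) : HasDerivAt (chi k) (chiDeriv k y) y := by
  have hm := continuous_mollifier k
  set p : ℝ → ℂ := fun w => (mollifier k w : ℂ) * Complex.exp (Complex.I * w) with hp
  have hpc : Continuous p := by fun_prop
  have hA : ∀ u, HasDerivAt (fun u => ∫ w in (0 : ℝ)..u, p w) (p u) u := fun u =>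
    (hpc.integral_hasStrictDerivAt 0 u).hasDerivAt
  have hG : HasDerivAt (fun y : ℝ => ∫ w in (y - 2 * eps k)..(y + 2 * eps k), p w)
      (p (y + 2 * eps k) - p (y - 2 * eps k)) y := by
    have h1 := (hA (y + 2 * eps k)).comp_add_const y (2 * eps k)
    have h2 := (hA (y - 2 * eps k)).comp_sub_const y (2 * eps k)
    refine (h1.sub h2).congr_of_eventuallyEq (Eventually.of_forall fun v => ?_)
    exact (intervalIntegral.integral_interval_sub_left (hpc.intervalIntegrable _ _)
      (hpc.intervalIntegrable _ _)).symm
  have hE : HasDerivAt (fun y : ℝ => (Real.Gamma (1 / expo k + 1) : ℂ) *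
      Complex.exp (-(Complex.I * y))) ((Real.Gamma (1 / expo k + 1) : ℂ) *
        (Complex.exp (-(Complex.I * y)) * -Complex.I)) y := by
    have h1 : HasDerivAt (fun y : ℝ => Complex.I * (y : ℂ)) Complex.I y := by
      simpa using (hasDerivAt_id y).ofReal_comp.const_mul Complex.I
    have h2 : HasDerivAt (fun y : ℝ => -(Complex.I * (y : ℂ))) (-Complex.I) y := h1.neg
    exact h2.cexp.const_mul _
  rw [show chi k = _ from funext (chi_eq_integral k)]
  refine (hE.mul hG).congr_deriv ?_
  rw [chiDeriv, chi_eq_integral]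
  ring

lemma continuous_chiDeriv (k : ℕ) : Continuous (chiDeriv k) := by
  have hm := continuous_mollifier k
  have hc : Continuous (chi k) :=
    continuous_iff_continuousAt.2 fun y => (hasDerivAt_chi k y).continuousAt
  unfold chiDeriv
  fun_prop

lemma norm_chiDeriv_le (k : ℕ) (y : ℝ) : ‖chiDeriv k y‖ ≤ Real.Gamma (1 / expo k + 1) *
    (1 + (mollifier k (y + 2 * eps k) + mollifier k (y - 2 * eps k))) := by
  have hΓ := gamma_pos k
  have hexp : ∀ x : ℝ, ‖Complex.exp (Complex.I * x)‖ = 1 := fun x => by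
    rw [mul_comm, Complex.norm_exp_ofReal_mul_I]
  have hexp' : ‖Complex.exp (-(Complex.I * y))‖ = 1 := by
    have := hexp (-y)
    rwa [Complex.ofReal_neg, mul_neg] at this
  have hchi := norm_chi_le k y
  rw [hk_zero, Complex.norm_real, Real.norm_of_nonneg hΓ.le] at hchi
  rw [chiDeriv, mul_add, mul_one]
  refine (norm_add_le _ _).trans (add_le_add ?_ ?_)
  · simpa using hchi
  · rw [norm_mul, norm_mul, hexp', Complex.norm_real, Real.norm_of_nonneg hΓ.le, mul_one]
    refine mul_le_mul_of_nonneg_left ((norm_sub_le _ _).trans_eq ?_) hΓ.le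
    rw [norm_mul, norm_mul, hexp, hexp, Complex.norm_real, Complex.norm_real,
      Real.norm_of_nonneg (mollifier_nonneg k _), Real.norm_of_nonneg (mollifier_nonneg k _),
      mul_one, mul_one]

/-- The constant is `6 * eps k ≤ 3` from the interval length, plus one for each of the two
translated mollifiers. -/
lemma integral_norm_chiDeriv_le (k : ℕ) :
    ∫ y in (-(3 * eps k))..(3 * eps k), ‖chiDeriv k y‖ ≤ 5 * Real.Gamma (1 / expo k + 1) := by
  have he := eps_pos k
  have he' := eps_le k
  have hΓ := gamma_pos k
  have hm := continuous_mollifier k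
  have hab : -(3 * eps k) ≤ 3 * eps k := by linarith
  have hbound : ∀ {g : ℝ → ℝ}, Integrable g → (∀ y, 0 ≤ g y) → ∫ y, g y = 1 →
      ∫ y in (-(3 * eps k))..(3 * eps k), g y ≤ 1 := fun {g} hg h0 h1 => by
    rw [intervalIntegral.integral_of_le hab, ← h1]
    exact setIntegral_le_integral hg (Eventually.of_forall h0)
  have h1 := hbound ((integrable_mollifier k).comp_add_right (2 * eps k))
    (fun y => mollifier_nonneg k _) (by
      rw [integral_add_right_eq_self (mollifier k), integral_mollifier])
  have h2 := hbound ((integrable_mollifier k).comp_sub_right (2 * eps k))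
    (fun y => mollifier_nonneg k _) (by
      rw [integral_sub_right_eq_self (mollifier k), integral_mollifier])
  have hc1 : Continuous fun y => mollifier k (y + 2 * eps k) := by fun_prop
  have hc2 : Continuous fun y => mollifier k (y - 2 * eps k) := by fun_prop
  have hc12 : Continuous fun y => mollifier k (y + 2 * eps k) + mollifier k (y - 2 * eps k) :=
    hc1.add hc2
  calc _ ≤ ∫ y in (-(3 * eps k))..(3 * eps k), Real.Gamma (1 / expo k + 1) *
        (1 + (mollifier k (y + 2 * eps k) + mollifier k (y - 2 * eps k))) :=
        intervalIntegral.integral_mono_on hab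
          ((continuous_chiDeriv k).norm.intervalIntegrable _ _)
          (Continuous.intervalIntegrable (by fun_prop) _ _) fun y _ => norm_chiDeriv_le k y
    _ = Real.Gamma (1 / expo k + 1) * (6 * eps k +
        ((∫ y in (-(3 * eps k))..(3 * eps k), mollifier k (y + 2 * eps k)) +
          ∫ y in (-(3 * eps k))..(3 * eps k), mollifier k (y - 2 * eps k))) := by
        rw [intervalIntegral.integral_const_mul, intervalIntegral.integral_add
          (continuous_const.intervalIntegrable _ _) (hc12.intervalIntegrable _ _),
          intervalIntegral.integral_add (hc1.intervalIntegrable _ _) (hc2.intervalIntegrable _ _),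
          intervalIntegral.integral_const]
        congr 2
        simp only [smul_eq_mul]; ring
    _ ≤ Real.Gamma (1 / expo k + 1) * 5 := mul_le_mul_of_nonneg_left (by linarith) hΓ.le
    _ = _ := mul_comm _ _

/-- The translates of `ξ_k` are superpositions of half-lines. -/
noncomputable def xiRep {n : ℕ} (hn : 1 ≤ n) (k : ℕ) (q : ℝ) :
    LineTailRep (fun x => xi n k (x - q)) 14 := by
  have he := eps_pos k
  have hΓ := gamma_pos k
  set C : ℂ := ((n : ℂ) * hk k 0 * alpha k)⁻¹ with hC
  have hCn : ‖C‖ * Real.Gamma (1 / expo k + 1) ≤ 2 := by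
    have hn1 : (1 : ℝ) ≤ n := by exact_mod_cast hn
    have hα := norm_alpha_ge k
    rw [hC, norm_inv, norm_mul, norm_mul, Complex.norm_natCast, hk_zero, Complex.norm_real,
      Real.norm_of_nonneg hΓ.le, inv_mul_le_iff₀ (by positivity)]
    calc Real.Gamma (1 / expo k + 1) = 1 * Real.Gamma (1 / expo k + 1) * (1 / 2) * 2 := by ring
      _ ≤ n * Real.Gamma (1 / expo k + 1) * ‖alpha k‖ * 2 := by gcongr
  refine LineTailRep.ofInterval (ψ := fun x => xi n k (x - q))
    (ψ' := fun x => C * -chiDeriv k (q - x)) (a := q - 3 * eps k) (b := q + 3 * eps k)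
    (by linarith) (fun t => ?_) ?_ (fun _ _ => rfl) (fun t ht => ?_) ?_ fun t =>
      (norm_xi_le n k _).trans (by norm_num)
  · have h := ((hasDerivAt_chi k (q - t)).comp_const_sub q t).const_mul C
    refine h.congr_of_eventuallyEq (Eventually.of_forall fun v => ?_)
    simp only [xi, neg_sub, ← hC]
  · have := continuous_chiDeriv k
    fun_prop
  · have : 3 * eps k < |-(t - q)| := by
      by_contra hcon
      rw [abs_neg, not_lt, abs_le] at hcon
      exact ht ⟨by linarith [hcon.1], by linarith [hcon.2]⟩
    simp only [xi, chi_eq_zero this, mul_zero]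
  · have h1 : ∫ t in (q - 3 * eps k)..(q + 3 * eps k), ‖C * -chiDeriv k (q - t)‖ =
        ‖C‖ * ∫ y in (-(3 * eps k))..(3 * eps k), ‖chiDeriv k y‖ := by
      simp only [norm_mul, norm_neg]
      rw [intervalIntegral.integral_const_mul,
        intervalIntegral.integral_comp_sub_left (fun y => ‖chiDeriv k y‖) q]
      congr 2 <;> ring
    have h2 := mul_le_mul_of_nonneg_left (integral_norm_chiDeriv_le k) (norm_nonneg C)
    have h3 := norm_xi_le n k (q - 3 * eps k - q)
    have h4 := norm_xi_le n k (q + 3 * eps k - q)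
    -- The endpoints give at most `2 + 2` and the variation at most `2 * 5`, whence `14`.
    rw [h1]
    linarith

/-! ### The Jones fields as superpositions of lower orthants -/

open Classical in
/-- The exponential `e^{iθ(x - q)} / N`, cut off outside `[q - ε_k, q + ε_k]`, is a superposition
of half-lines. -/
noncomputable def expRep {N : ℕ} (hN : 1 ≤ N) (k : ℕ) (q θ : ℝ) (hθ : |θ| ≤ 1) :
    LineTailRep (fun x => if |x - q| ≤ eps k then
      1 / (N : ℂ) * Complex.exp (Complex.I * (θ * (x - q) : ℝ)) else 0) 14 := by
  have he := eps_pos k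
  have he' := eps_le k
  have hN1 : ‖1 / (N : ℂ)‖ ≤ 1 := by
    rw [norm_div, norm_one, Complex.norm_natCast]
    exact div_le_one_of_le₀ (by exact_mod_cast hN) (Nat.cast_nonneg _)
  have hexp : ∀ x : ℝ, ‖Complex.exp (Complex.I * x)‖ = 1 := fun x => by
    rw [mul_comm, Complex.norm_exp_ofReal_mul_I]
  have hψ : ∀ x : ℝ, ‖1 / (N : ℂ) * Complex.exp (Complex.I * (θ * (x - q) : ℝ))‖ ≤ 1 :=
    fun x => by rw [norm_mul, hexp, mul_one]; exact hN1
  have hmem : ∀ t, |t - q| ≤ eps k ↔ t ∈ Icc (q - eps k) (q + eps k) := fun t => by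
    rw [abs_le, mem_Icc]
    constructor <;> rintro ⟨h, h'⟩ <;> constructor <;> linarith
  refine LineTailRep.ofInterval
    (ψ := fun x : ℝ => 1 / (N : ℂ) * Complex.exp (Complex.I * (θ * (x - q) : ℝ)))
    (ψ' := fun x : ℝ => 1 / (N : ℂ) * (Complex.exp (Complex.I * (θ * (x - q) : ℝ)) *
      (Complex.I * θ)))
    (a := q - eps k) (b := q + eps k) (by linarith) (fun t => ?_) (by fun_prop)
    (fun t ht => if_pos ((hmem t).2 ht)) (fun t ht => if_neg fun h => ht ((hmem t).1 h)) ?_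
    fun t => ?_
  · have h1 : HasDerivAt (fun x : ℝ => Complex.I * ((θ * (x - q) : ℝ) : ℂ)) (Complex.I * θ) t := by
      have := (((hasDerivAt_id t).sub_const q).const_mul θ).ofReal_comp.const_mul Complex.I
      simpa using this
    exact h1.cexp.const_mul _
  · have h1 : ∫ t in (q - eps k)..(q + eps k), ‖1 / (N : ℂ) *
        (Complex.exp (Complex.I * (θ * (t - q) : ℝ)) * (Complex.I * θ))‖ ≤
        ∫ t in (q - eps k)..(q + eps k), (1 : ℝ) := by
      refine intervalIntegral.integral_mono_on (by linarith)
        (Continuous.intervalIntegrable (by fun_prop) _ _) (by simp) fun t _ => ?_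
      rw [← mul_assoc, norm_mul]
      refine mul_le_one₀ (hψ t) (norm_nonneg _) ?_
      simpa using hθ
    rw [intervalIntegral.integral_const, smul_eq_mul, mul_one] at h1
    have h2 := hψ (q - eps k)
    have h3 := hψ (q + eps k)
    linarith
  · split_ifs
    · exact (hψ t).trans (by norm_num)
    · simp

/-- The components of the vector-valued Jones fields are superpositions of lower orthants. -/
noncomputable def vectorFieldsRep {n : ℕ} (hn : 1 ≤ n) (σ : ℕ ≃ ℕ × (Fin n → ℚ)) (m : ℕ)
    (j : Fin n) : TailRep (fun x => (vectorFields n σ).E m x j) (14 ^ n) := by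
  classical
  set k := (σ m).1 + 1
  set q : Fin n → ℝ := fun l => ((σ m).2 l : ℝ)
  -- The cut-off to a cube is a product over the coordinates. The `j`-th factor carries the
  -- exponential and `1 / n`; the others are plain cut-offs, with frequency `0` and `N = 1`.
  have e : (fun x => (vectorFields n σ).E m x j) = fun x : Fin n → ℝ => ∏ l,
      if |x l - q l| ≤ eps k then 1 / ((if l = j then n else 1 : ℕ) : ℂ) *
        Complex.exp (Complex.I * ((if l = j then 1 else 0) * (x l - q l) : ℝ)) else 0 := by
    funext x
    change (if ∀ l, |x l - q l| ≤ eps k then xi n k (x j - q j) else 0) = _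
    rw [Finset.prod_ite_zero]
    simp only [Finset.mem_univ, true_imp_iff]
    split_ifs with h
    · rw [xi_eq (h j), Finset.prod_eq_single_of_mem j (Finset.mem_univ j) fun l _ hl => by
        simp [hl]]
      simp
    · rfl
  rw [e]
  refine LineTailRep.prod (φ := fun l y => if |y - q l| ≤ eps k then
    1 / ((if l = j then n else 1 : ℕ) : ℂ) *
      Complex.exp (Complex.I * ((if l = j then 1 else 0) * (y - q l) : ℝ)) else 0)
    fun l => expRep (N := if l = j then n else 1) ?_ k (q l) (if l = j then 1 else 0) ?_
  · split_ifs
    · exact hn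
    · exact le_rfl
  · split_ifs <;> simp

/-- The scalar Jones functions are superpositions of lower orthants. -/
noncomputable def scalarFieldsRep {n : ℕ} (hn : 1 ≤ n) (σ : ℕ ≃ ℕ × (Fin n → ℚ)) (m : ℕ)
    (j : Fin 1) : TailRep (fun x => (scalarFields n σ).E m x j) (14 ^ n) :=
  LineTailRep.prod fun l => xiRep hn ((σ m).1 + 1) ((σ m).2 l : ℝ)

end Jones

theorem mainTheorem6 (n : ℕ) (hn : 1 ≤ n) :
    ∃ C : ℝ, ∀ σ : ℕ ≃ ℕ × (Fin n → ℚ),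
      (∀ f : (Fin n → ℝ) → Fin n → ℂ, (∀ j, Jones.HKIntegrable fun x => f x j) →
        ∃ u : Jones.SD2 (Jones.vectorFields n σ),
          Jones.Represents (Jones.vectorFields n σ) f u ∧
          (∀ v, Jones.Represents (Jones.vectorFields n σ) f v → v = u) ∧
          ‖u‖ ≤ C * ∑ j, Jones.alexiewiczNorm fun x => f x j) ∧
      (∀ f : (Fin n → ℝ) → ℂ, Jones.HKIntegrable f →
        ∃ u : Jones.SD2 (Jones.scalarFields n σ),
          Jones.Represents (Jones.scalarFields n σ) (fun x _ => f x) u ∧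
          (∀ v, Jones.Represents (Jones.scalarFields n σ) (fun x _ => f x) v → v = u) ∧
          ‖u‖ ≤ C * Jones.alexiewiczNorm f) := by
  -- Each of the `n` one-dimensional factors has constant `14`, and products multiply the constants.
  refine ⟨14 ^ n, fun σ => ⟨fun f hf => ?_, fun f hf => ?_⟩⟩
  · exact Jones.exists_represents _ (Jones.vectorFieldsRep hn σ) hf
  · simpa using Jones.exists_represents _ (Jones.scalarFieldsRep hn σ)
      (f := fun x _ => f x) fun _ => hf
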